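/- **Setting.** Let $p,K,N$ be nonnegative integers, $O_1,\dots,O_K\subseteq[p]=\{1,\dots,p\}$ missingness patterns, $n_1,\dots,n_K$ nonnegative integers and $n_{\mathcal L}=\sum_{k=1}^K n_k$. A data-generating mechanism $P$ consists of a joint law of $(X,Y)\in\mathbb R^p\times\mathbb R$, a vector $\beta^*\in\mathbb R^p$ and $\sigma\ge 0$ such that $$Y=X^T\beta^*+\epsilon,\qquad \mathbb E[\epsilon\mid X]=0,\qquad \mathrm{Var}[\epsilon\mid X]=\sigma^2,$$ where $X$ has a finite second moment matrix $\Sigma=\mathbb E[XX^T]$. The data consist of jointly independent observations: for each $k\in[K]$, $n_k$ i.i.d. copies of $(X_{O_k},Y)$, and in addition $N$ i.i.d. (unlabelled) copies of $X$. Let $\mathcal X$ be the corresponding sample space. For $R_X,R,B,\Phi_\Sigma>0$ and an integer $s$ with $2\le s\le p$, let $\mathcal P_{HD}=\mathcal P_{HD}(R_X,R,B,s,\Phi_\Sigma)$ be the class of mechanisms for which: * $\mathbb E[X]=0$ and $\|X\|_{\psi_2}=\sup_{\|u\|_2=1}\inf\{c>0:\mathbb E\exp(\langle u,X\rangle^2/c^2)\le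 2\}\le R_X$; * $\epsilon$ is sub-Gaussian with parameter $\sigma$, i.e. $\mathbb E e^{t\epsilon}\le e^{\sigma^2t^2/2}$ for all $t\in\mathbb R$; * $\phi^2(\Sigma,s)\ge\Phi_\Sigma$, where $$\phi^2(A,s)=\inf_{S\subseteq[p],\,|S|\le s}\ \inf_{\delta\ne0,\ \|\delta_{S^c}\|_1\le\|\delta_S\|_1}\frac{\delta^TA\delta}{\|\delta_{M(\delta)}\|_2^2},\qquad M(\delta)=S\cup\{i\in S^c:|\delta_i|\ge|\delta_{S^c}|_{(\min\{s,|S^c|\})}\},$$ and $|\delta_{S^c}|_{(j)}$ is the $j$-th largest absolute value of the entries of $\delta_{S^c}$ (if $S^c=\emptyset$, then $M(\delta)=S$); * $\|\beta^*\|_0\le s$, $\|\beta^*\|_2\le B$ and $\sigma\le R$. Let $\hat\Theta_{HD}$ be the set of functions $\hat\beta:\mathcal X\to\mathbb R^p$ such that $x\mapsto\|\hat\beta(x)-\beta^*(P)\|_2$ is measurable for every $P\in\mathcal P_{HD}$. **Theorem.** Suppose that $\Phi_\Sigma<\frac{3R_X^2}{16}$ and that, for some $\rho\in(0,1)$ and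 $C_\rho>1$, there exists $j\in[p]$ such that for all $i\in[p]\setminus\{j\}$, $$\sum_{k=1}^K n_k\mathbf 1_{\{i,j\in O_k\}}\le C_\rho\rho^2n_{\mathcal L}.$$ If $s\ge2$, $p-2\ge24(s-1)^2$ and $$C_\rho\rho^2n_{\mathcal L}+N\ \ge\ \frac{128\,s\log(p-2)}{9}\max\Big\{1,\frac1{R_X^4}\Big\}\min\Big\{\frac{R^2}{B^2},1\Big\},$$ then $$\inf_{\hat\beta\in\hat\Theta_{HD}}\ \sup_{P\in\mathcal P_{HD}}\mathbb E\big[\|\hat\beta-\beta^*\|_2^2\big]\ \ge\ \frac{1}{2^{17}C_\rho}\min\Big\{1,\frac{2^6}{3^2R_X^4}\Big\}\,\frac{\min\{R^2,B^2\}\,s\log\big(\frac{p-1}{2(s-1)}\big)}{\rho^2n_{\mathcal L}+N}.$$ -/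

import Mathlib

open MeasureTheory ProbabilityTheory
open scoped ENNReal NNReal

noncomputable section

namespace HDMissing

/-! ### Sub-Gaussian norm -/

/-- The sub-Gaussian norm `inf {K > 0 : E exp (Z² / K²) ≤ 2}` of a real random variable,
with value `∞` when no such `K` exists. -/
def psiTwoNorm {Ω : Type*} [MeasurableSpace Ω] (Z : Ω → ℝ) (μ : Measure Ω) : ℝ≥0∞ :=
  ⨅ (K : ℝ≥0) (_ : 0 < K)
    (_ : ∫⁻ ω, ENNReal.ofReal (Real.exp (Z ω ^ 2 / (K : ℝ) ^ 2)) ∂μ ≤ 2), (K : ℝ≥0∞)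

/-- The sub-Gaussian norm of a random vector: the supremum over unit vectors `u` of the
sub-Gaussian norm of `⟨u, X⟩`. -/
def vecPsiTwoNorm {Ω : Type*} [MeasurableSpace Ω] {p : ℕ}
    (X : Ω → EuclideanSpace ℝ (Fin p)) (μ : Measure Ω) : ℝ≥0∞ :=
  ⨆ (u : EuclideanSpace ℝ (Fin p)) (_ : ‖u‖ = 1), psiTwoNorm (fun ω => inner ℝ u (X ω)) μ

/-! ### The restricted eigenvalue condition -/

/-- The `j`-th largest (counted from `1`, with multiplicity) of the numbers `|δ i|`, `i ∈ T`. -/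
def kthLargestAbs {p : ℕ} (δ : Fin p → ℝ) (T : Finset (Fin p)) (j : ℕ) : ℝ :=
  ((T.val.map fun i => |δ i|).sort (fun a b => b ≤ a)).getD (j - 1) 0

/-- `S` together with the indices outside `S` at which `|δ|` is at least its
`min {s, |Sᶜ|}`-th largest value on `Sᶜ`. -/
def reSupport {p : ℕ} (s : ℕ) (S : Finset (Fin p)) (δ : Fin p → ℝ) : Finset (Fin p) :=
  S ∪ {i ∈ Sᶜ | kthLargestAbs δ Sᶜ (min s Sᶜ.card) ≤ |δ i|}

/-- The restricted eigenvalue `φ²(A, s)`, as an extended real infimum. -/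
def phiSq {p : ℕ} (A : Matrix (Fin p) (Fin p) ℝ) (s : ℕ) : EReal :=
  ⨅ (S : Finset (Fin p)) (_ : S.card ≤ s) (δ : Fin p → ℝ) (_ : δ ≠ 0)
    (_ : ∑ i ∈ Sᶜ, |δ i| ≤ ∑ i ∈ S, |δ i|),
    ((dotProduct δ (A.mulVec δ) / ∑ i ∈ reSupport s S δ, δ i ^ 2 : ℝ) : EReal)

/-- The condition `Re(s, Φ)`. -/
def SatisfiesRE {p : ℕ} (A : Matrix (Fin p) (Fin p) ℝ) (s : ℕ) (Φ : ℝ) : Prop :=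
  (Φ : EReal) ≤ phiSq A s

/-! ### The linear model -/

/-- A data-generating mechanism: the joint law of `(X, Y)` in `ℝᵖ × ℝ`, with
`Y = Xᵀβ + ε`, `E[ε | X] = 0` and `Var[ε | X] = σ²`, where `X` has a second moment matrix. -/
structure Mechanism (p : ℕ) where
  law : Measure (EuclideanSpace ℝ (Fin p) × ℝ)
  beta : EuclideanSpace ℝ (Fin p)
  sigma : ℝ≥0
  isProb : IsProbabilityMeasure law
  memLp_cov : MemLp (fun z => z.1) 2 law
  memLp_noise : MemLp (fun z => z.2 - inner ℝ beta z.1) 2 law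
  cond_mean : law[fun z => z.2 - inner ℝ beta z.1 | MeasurableSpace.comap Prod.fst inferInstance]
    =ᵐ[law] fun _ => 0
  cond_var : condVar (MeasurableSpace.comap Prod.fst inferInstance)
    (fun z => z.2 - inner ℝ beta z.1) law =ᵐ[law] fun _ => (sigma : ℝ) ^ 2

namespace Mechanism

variable {p : ℕ}

/-- The noise variable `ε = Y - Xᵀβ`. -/
def noise (P : Mechanism p) (z : EuclideanSpace ℝ (Fin p) × ℝ) : ℝ :=
  z.2 - inner ℝ P.beta z.1

/-- The matrix `E[X Xᵀ]`. -/
def secondMoment (P : Mechanism p) : Matrix (Fin p) (Fin p) ℝ :=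
  Matrix.of fun i j => ∫ z, z.1 i * z.1 j ∂P.law

end Mechanism

/-- The class `𝒫_HD(R_X, R, B, s, Φ)`. -/
def classHD (p : ℕ) (RX R B : ℝ) (s : ℕ) (Φ : ℝ) : Set (Mechanism p) :=
  {P | vecPsiTwoNorm (fun z => z.1) P.law ≤ ENNReal.ofReal RX ∧
    ∫ z, z.1 ∂P.law = 0 ∧
    HasSubgaussianMGF P.noise (P.sigma ^ 2) P.law ∧
    SatisfiesRE P.secondMoment s Φ ∧
    Finset.card {i | P.beta i ≠ 0} ≤ s ∧
    ‖P.beta‖ ≤ B ∧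
    (P.sigma : ℝ) ≤ R}

/-! ### Observations with missing covariates -/

/-- The sample space: `n k` observations of `(X_{O k}, Y)` for each pattern `k`, and `N`
complete observations of `X`. -/
abbrev SampleSpace {p K : ℕ} (O : Fin K → Finset (Fin p)) (n : Fin K → ℕ) (N : ℕ) : Type :=
  ((k : Fin K) → Fin (n k) → (O k → ℝ) × ℝ) × (Fin N → EuclideanSpace ℝ (Fin p))

/-- The map `(x, y) ↦ (x_T, y)`. -/
def restrictObs {p : ℕ} (T : Finset (Fin p)) (z : EuclideanSpace ℝ (Fin p) × ℝ) :
    (T → ℝ) × ℝ :=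
  (fun i => z.1 i, z.2)

/-- The law of the data: all observations are independent, those of pattern `k` having the law
of `(X_{O k}, Y)` and the unlabelled ones that of `X`. -/
def dataLaw {p K : ℕ} (O : Fin K → Finset (Fin p)) (n : Fin K → ℕ) (N : ℕ) (P : Mechanism p) :
    Measure (SampleSpace O n N) :=
  (Measure.pi fun k => Measure.pi fun _ : Fin (n k) => P.law.map (restrictObs (O k))).prod
    (Measure.pi fun _ : Fin N => P.law.map Prod.fst)

/-- The estimators `β̂` for which `‖β̂ - β*(P)‖` is measurable for every `P` in the class. -/
def estimators {p K : ℕ} (O : Fin K → Finset (Fin p)) (n : Fin K → ℕ) (N : ℕ)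
    (Q : Set (Mechanism p)) : Set (SampleSpace O n N → EuclideanSpace ℝ (Fin p)) :=
  {b | ∀ P ∈ Q, Measurable fun d => ‖b d - P.beta‖}

/-- The minimax risk for the squared Euclidean loss, in `[0, ∞]`. -/
def minimaxRisk {p K : ℕ} (O : Fin K → Finset (Fin p)) (n : Fin K → ℕ) (N : ℕ)
    (Q : Set (Mechanism p)) : ℝ≥0∞ :=
  ⨅ b ∈ estimators O n N Q, ⨆ P ∈ Q,
    ∫⁻ d, ENNReal.ofReal (‖b d - P.beta‖ ^ 2) ∂(dataLaw O n N P)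

end HDMissing

end

/-! The bound is a many-hypotheses argument over Gaussian models indexed by a sparse direction `ℓ`
with `ℓ j = 0`. With independent standard sources `z`, `g`, `e`, the covariates are `a zᵢ` for `i ≠
j` and `a (⟨ℓ, z⟩ + w g)` for `i = j`, where `w² = 1 - ‖ℓ‖²`, and the response is `a b w g + σ e`.
Since `⟨e_j - ℓ, X⟩ = a w g`, the regression vector is `b (e_j - ℓ)`, so estimating it means
estimating `ℓ`. The response does not involve the covariates other than the `j`-th, so `ℓ` is
visible only through the dependence between `X_j` and the other observed covariates. An observation
of pattern `T` is uninformative if `j ∉ T`, and otherwise sees `ℓ` only on `T`.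

All models with the same `‖ℓ‖` are compared with one reference law, in which `X_j` keeps its
variance and its joint law with `Y` but is independent of the other covariates. For a pattern
containing `j` the second moment of the likelihood ratio is at most `1 + ‖ℓ_T‖² / v`, with `v =
residVar` (`chiSqLE_map_maskObs`). Tensorization and the balance hypothesis on pairs `(i, j)` bound
that of the whole sample by `exp ((D + N) ‖ℓ‖² / v)` (`chiSqLE_sampleLaw_modelLaw`).

The directions are multiples of indicators of `k`-sets, `k = s - 1`, whose pairwise intersections
have at most `k/2` elements; polynomial graphs over a prime field supply exponentially many
(`exists_packing`). If the likelihood ratios have second moment at most a quarter of the number of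
hypotheses, no estimator can be close to the truth with probability above 1/2 under every hypothesis
(`exists_le_lintegral_norm_sub_sq`). It remains to choose the amplitude of the entries of `ℓ`. -/

open MeasureTheory ProbabilityTheory
open scoped ENNReal NNReal

noncomputable section

namespace HDMissing

/-! ### Second-moment domination of measures -/

/-- `P` has a density with respect to `Q` whose second moment is at most `c`, stated through
the Cauchy-Schwarz inequality it implies. -/
def ChiSqLE {α : Type*} [MeasurableSpace α] (P Q : Measure α) (c : ℝ≥0∞) : Prop :=
  ∀ f : α → ℝ≥0∞, Measurable f → (∫⁻ x, f x ∂P) ^ 2 ≤ c * ∫⁻ x, f x ^ 2 ∂Q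

theorem lintegral_mul_sq_le {α : Type*} [MeasurableSpace α] (μ : Measure α) {f g : α → ℝ≥0∞}
    (hf : Measurable f) (hg : Measurable g) :
    (∫⁻ x, f x * g x ∂μ) ^ 2 ≤ (∫⁻ x, f x ^ 2 ∂μ) * ∫⁻ x, g x ^ 2 ∂μ := by
  have h := ENNReal.lintegral_mul_le_Lp_mul_Lq μ Real.HolderConjugate.two_two
    hf.aemeasurable hg.aemeasurable
  calc (∫⁻ x, f x * g x ∂μ) ^ 2
      ≤ ((∫⁻ x, f x ^ (2 : ℝ) ∂μ) ^ (1 / 2 : ℝ) * (∫⁻ x, g x ^ (2 : ℝ) ∂μ) ^ (1 / 2 : ℝ)) ^ 2 := by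
        gcongr
        simpa using h
    _ = _ := by
        rw [mul_pow, ← ENNReal.rpow_natCast, ← ENNReal.rpow_natCast, ← ENNReal.rpow_mul,
          ← ENNReal.rpow_mul]
        norm_num

namespace ChiSqLE

variable {α β : Type*} [MeasurableSpace α] [MeasurableSpace β]

theorem refl (P : Measure α) [IsProbabilityMeasure P] : ChiSqLE P P 1 := by
  intro f hf
  simpa using lintegral_mul_sq_le P measurable_const hf (f := fun _ => 1)

theorem mono {P Q : Measure α} {c d : ℝ≥0∞} (h : ChiSqLE P Q c) (hcd : c ≤ d) :
    ChiSqLE P Q d := fun f hf => (h f hf).trans (by gcongr)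

theorem map {P Q : Measure α} {c : ℝ≥0∞} (h : ChiSqLE P Q c) {g : α → β} (hg : Measurable g) :
    ChiSqLE (P.map g) (Q.map g) c := by
  intro f hf
  rw [lintegral_map hf hg, lintegral_map (hf.pow_const 2) hg]
  exact h _ (hf.comp hg)

/-- Tensorization needs no densities in this form: the first bound is applied to the partial
integral of `f`, the second to each of its sections. -/
theorem prod {P₁ Q₁ : Measure α} {P₂ Q₂ : Measure β} [SFinite P₂] [SFinite Q₂]
    {c₁ c₂ : ℝ≥0∞} (h₁ : ChiSqLE P₁ Q₁ c₁) (h₂ : ChiSqLE P₂ Q₂ c₂) :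
    ChiSqLE (P₁.prod P₂) (Q₁.prod Q₂) (c₁ * c₂) := by
  intro f hf
  rw [lintegral_prod _ hf.aemeasurable, lintegral_prod _ (hf.pow_const 2).aemeasurable]
  calc (∫⁻ x, ∫⁻ y, f (x, y) ∂P₂ ∂P₁) ^ 2
      ≤ c₁ * ∫⁻ x, (∫⁻ y, f (x, y) ∂P₂) ^ 2 ∂Q₁ := h₁ _ hf.lintegral_prod_right'
    _ ≤ c₁ * ∫⁻ x, c₂ * ∫⁻ y, f (x, y) ^ 2 ∂Q₂ ∂Q₁ := by
        gcongr with x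
        exact h₂ _ (hf.comp measurable_prodMk_left)
    _ = c₁ * c₂ * ∫⁻ x, ∫⁻ y, f (x, y) ^ 2 ∂Q₂ ∂Q₁ := by
        rw [lintegral_const_mul _ (hf.pow_const 2).lintegral_prod_right', mul_assoc]

theorem pi : ∀ {n : ℕ} {X : Fin n → Type} [∀ i, MeasurableSpace (X i)]
    {P Q : ∀ i, Measure (X i)} [∀ i, IsProbabilityMeasure (P i)]
    [∀ i, IsProbabilityMeasure (Q i)] {c : Fin n → ℝ≥0∞},
    (∀ i, ChiSqLE (P i) (Q i) (c i)) → ChiSqLE (Measure.pi P) (Measure.pi Q) (∏ i, c i)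
  | 0, X, _, P, Q, _, _, c, _ => by
      rw [Measure.pi_of_empty P (fun i => i.elim0), Measure.pi_of_empty Q (fun i => i.elim0)]
      simpa using refl _
  | n + 1, X, _, P, Q, _, _, c, h => by
      have hP := (measurePreserving_piFinSuccAbove P 0).symm
      have hQ := (measurePreserving_piFinSuccAbove Q 0).symm
      rw [← hP.map_eq, ← hQ.map_eq, Fin.prod_univ_succ]
      exact ((h 0).prod (pi fun i => h i.succ)).map (MeasurableEquiv.measurable _)

theorem measure_sq_le {P Q : Measure α} {c : ℝ≥0∞} (h : ChiSqLE P Q c) {s : Set α}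
    (hs : MeasurableSet s) : P s ^ 2 ≤ c * Q s := by
  have := h (s.indicator 1) (measurable_one.indicator hs)
  rw [lintegral_indicator_one hs] at this
  refine this.trans_eq ?_
  congr 1
  rw [← lintegral_indicator_one hs]
  congr 1 with x
  by_cases hx : x ∈ s <;> simp [hx]

end ChiSqLE

/-! ### Gaussian integrals -/

theorem lintegral_gaussianReal (μ : ℝ) {v : ℝ≥0} (hv : v ≠ 0) {f : ℝ → ℝ≥0∞} (hf : Measurable f) :
    ∫⁻ x, f x ∂(gaussianReal μ v) = ∫⁻ x, gaussianPDF μ v x * f x := by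
  rw [gaussianReal_of_var_ne_zero _ hv,
    lintegral_withDensity_eq_lintegral_mul _ (measurable_gaussianPDF _ _) hf]
  rfl

/-- Tilting the centred Gaussian density of variance `v` by `exp (c x²)` gives a multiple of the one
of variance `v / (1 - 2cv)`. -/
theorem lintegral_exp_mul_sq_gaussianReal (v : ℝ≥0) {c : ℝ} (hc : 2 * c * v < 1) :
    ∫⁻ x, ENNReal.ofReal (Real.exp (c * x ^ 2)) ∂(gaussianReal 0 v)
      = ENNReal.ofReal (√(1 - 2 * c * v))⁻¹ := by
  rcases eq_or_ne v 0 with rfl | hv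
  · simp [gaussianReal_zero_var]
  have hd : 0 < 1 - 2 * c * v := by linarith
  have hv0 : (0 : ℝ) < v := by positivity
  obtain ⟨d, hd'⟩ : ∃ d : ℝ≥0, (d : ℝ) = v / (1 - 2 * c * v) := ⟨⟨_, by positivity⟩, rfl⟩
  have hd0 : d ≠ 0 := by
    rw [← NNReal.coe_ne_zero, hd']; positivity
  rw [lintegral_gaussianReal 0 hv (by fun_prop)]
  have key : ∀ x, gaussianPDF 0 v x * ENNReal.ofReal (Real.exp (c * x ^ 2))
      = ENNReal.ofReal (√(1 - 2 * c * v))⁻¹ * gaussianPDF 0 d x := by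
    intro x
    rw [gaussianPDF, gaussianPDF, ← ENNReal.ofReal_mul (gaussianPDFReal_nonneg _ _ _),
      ← ENNReal.ofReal_mul (by positivity)]
    congr 1
    have hs : (√(2 * Real.pi * v))⁻¹ = (√(1 - 2 * c * v))⁻¹ * (√(2 * Real.pi * d))⁻¹ := by
      rw [← mul_inv, ← Real.sqrt_mul hd.le]
      rw [hd']
      rw [mul_left_comm, mul_div_cancel₀ _ hd.ne']
    rw [gaussianPDFReal, gaussianPDFReal, hs, mul_assoc, mul_assoc, mul_assoc, ← Real.exp_add]
    congr 3
    rw [hd']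
    field_simp
    ring
  simp_rw [key]
  rw [lintegral_const_mul _ (measurable_gaussianPDF _ _), lintegral_gaussianPDF_eq_one _ hd0,
    mul_one]

/-- Completing the square in `u`: the result is again a Gaussian density up to a factor, so it
integrates at once and leaves only an exponential of `m²`. -/
theorem gaussianPDFReal_sq_div {m u : ℝ} {τ s κ : ℝ≥0} (hs : s ≠ 0)
    (hκ : (κ : ℝ) = s * (s + τ) / (s + 2 * τ)) :
    gaussianPDFReal m s u ^ 2 / gaussianPDFReal 0 (τ + s) u
      = (s + τ) / s * √(s / (s + 2 * τ)) * Real.exp (1 / (s + 2 * τ) * m ^ 2)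
        * gaussianPDFReal (2 * m * (s + τ) / (s + 2 * τ)) κ u := by
  have hs0 : (0 : ℝ) < s := by positivity
  have hpi := Real.pi_pos
  have hc : (√(2 * Real.pi * s))⁻¹ ^ 2 * √(2 * Real.pi * (τ + s : ℝ≥0))
      = (s + τ) / s * √(s / (s + 2 * τ)) * (√(2 * Real.pi * κ))⁻¹ := by
    have h1 : √(2 * Real.pi * (τ + s : ℝ≥0)) * √(2 * Real.pi * κ)
        = 2 * Real.pi * (s + τ) * √(s / (s + 2 * τ)) := by
      rw [← Real.sqrt_mul (by positivity), hκ,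
        ← Real.sqrt_sq (show 0 ≤ 2 * Real.pi * (s + τ : ℝ) by positivity),
        ← Real.sqrt_mul (by positivity)]
      congr 1
      push_cast
      field_simp
      ring
    have h2 : √(2 * Real.pi * κ) ≠ 0 := by
      rw [hκ]; positivity
    rw [inv_pow, Real.sq_sqrt (by positivity)]
    field_simp
    rw [mul_comm _ (√_), mul_comm (2 * Real.pi)] at *
    field_simp at h1 ⊢
    linarith
  have he : Real.exp (-(u - m) ^ 2 / (2 * s)) ^ 2
      = Real.exp (1 / (s + 2 * τ) * m ^ 2)
        * Real.exp (-(u - 2 * m * (s + τ) / (s + 2 * τ)) ^ 2 / (2 * κ))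
        * Real.exp (-(u - 0) ^ 2 / (2 * (τ + s : ℝ≥0))) := by
    rw [← Real.exp_nat_mul, ← Real.exp_add, ← Real.exp_add]
    congr 1
    rw [hκ]
    push_cast
    field_simp
    ring
  simp only [gaussianPDFReal]
  rw [div_eq_iff (by positivity), mul_pow, he]
  have h3 : √(2 * Real.pi * (τ + s : ℝ≥0)) ≠ 0 := by positivity
  calc _ = ((√(2 * Real.pi * s))⁻¹ ^ 2 * √(2 * Real.pi * (τ + s : ℝ≥0)))
        * (√(2 * Real.pi * (τ + s : ℝ≥0)))⁻¹ * (Real.exp (1 / (s + 2 * τ) * m ^ 2)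
        * Real.exp (-(u - 2 * m * (s + τ) / (s + 2 * τ)) ^ 2 / (2 * κ))
        * Real.exp (-(u - 0) ^ 2 / (2 * (τ + s : ℝ≥0)))) := by
        rw [mul_assoc _ (√_), mul_inv_cancel₀ h3, mul_one]
    _ = _ := by rw [hc]; ring

/-- A centred Gaussian shift of variance `τ` of a Gaussian variable of variance `s`, observed
together with the shift, is dominated by the independent coupling of the two marginals. -/
theorem chiSqLE_gaussian_shift {Ω : Type*} [MeasurableSpace Ω] (μ : Measure Ω)
    [IsProbabilityMeasure μ] {m : Ω → ℝ} (hm : Measurable m) {τ s : ℝ≥0}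
    (hτ : μ.map m = gaussianReal 0 τ) (hs : s ≠ 0) :
    ChiSqLE ((μ.prod (gaussianReal 0 s)).map fun q => (q.1, m q.1 + q.2))
      (μ.prod (gaussianReal 0 (τ + s))) (ENNReal.ofReal (1 + τ / s)) := by
  intro f hf
  have hs0 : (0 : ℝ) < s := by positivity
  have hτs : τ + s ≠ 0 := by positivity
  obtain ⟨κ, hκ⟩ : ∃ κ : ℝ≥0, (κ : ℝ) = s * (s + τ) / (s + 2 * τ) :=
    ⟨⟨_, by positivity⟩, rfl⟩
  have hκ0 : κ ≠ 0 := by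
    rw [← NNReal.coe_ne_zero, hκ]; positivity
  set L : Ω × ℝ → ℝ≥0∞ := fun q =>
    ENNReal.ofReal (gaussianPDFReal (m q.1) s q.2 / gaussianPDFReal 0 (τ + s) q.2) with hL
  have hmeas : Measurable fun q : Ω × ℝ => gaussianPDFReal (m q.1) s q.2 :=
    measurable_uncurry_gaussianPDFReal.comp
      ((hm.comp measurable_fst).prodMk (measurable_const.prodMk measurable_snd))
  have hLm : Measurable L :=
    (hmeas.div ((measurable_gaussianPDFReal _ _).comp measurable_snd)).ennreal_ofReal
  have h1 : ∫⁻ q, f q ∂((μ.prod (gaussianReal 0 s)).map fun q => (q.1, m q.1 + q.2))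
      = ∫⁻ q, f q * L q ∂(μ.prod (gaussianReal 0 (τ + s))) := by
    have hsh : Measurable fun q : Ω × ℝ => (q.1, m q.1 + q.2) := by fun_prop
    rw [lintegral_map hf hsh, lintegral_prod (fun q : Ω × ℝ => f (q.1, m q.1 + q.2)) (hf.comp hsh).aemeasurable,
      lintegral_prod (fun q => f q * L q) (hf.mul hLm).aemeasurable]
    congr 1 with ω
    have hfω : Measurable fun u => f (ω, u) := hf.comp measurable_prodMk_left
    have := gaussianReal_map_const_add (μ := 0) (v := s) (m ω)
    rw [zero_add] at this
    rw [← lintegral_map (f := fun u => f (ω, u)) hfω (measurable_const_add (m ω)), this,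
      lintegral_gaussianReal _ hs hfω,
      lintegral_gaussianReal _ hτs (f := fun u => f (ω, u) * L (ω, u))
        (hfω.mul (hLm.comp measurable_prodMk_left))]
    congr 1 with u
    have hp := gaussianPDFReal_pos 0 (τ + s) u hτs
    simp only [hL]
    rw [gaussianPDF, gaussianPDF, mul_comm (f _), ← mul_assoc, ← ENNReal.ofReal_mul hp.le,
      mul_div_cancel₀ _ hp.ne']
  -- The integral over `u` leaves `exp (m² / (s + 2τ))`, and `m` has law N(0, τ). The two
  -- square-root factors then cancel, so the constant is exact.
  have h2 : ∫⁻ q, L q ^ 2 ∂(μ.prod (gaussianReal 0 (τ + s))) = ENNReal.ofReal (1 + τ / s) := by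
    rw [lintegral_prod _ (hLm.pow_const 2).aemeasurable]
    have hin : ∀ ω, ∫⁻ u, L (ω, u) ^ 2 ∂(gaussianReal 0 (τ + s))
        = ENNReal.ofReal ((s + τ) / s * √(s / (s + 2 * τ)))
          * ENNReal.ofReal (Real.exp (1 / (s + 2 * τ) * m ω ^ 2)) := by
      intro ω
      have hLω : Measurable fun u => L (ω, u) := hLm.comp measurable_prodMk_left
      rw [lintegral_gaussianReal _ hτs (hLω.pow_const 2),
        ← ENNReal.ofReal_mul (by positivity), ← mul_one (ENNReal.ofReal _),
        ← lintegral_gaussianPDF_eq_one (2 * m ω * (s + τ) / (s + 2 * τ)) hκ0,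
        ← lintegral_const_mul _ (measurable_gaussianPDF _ _)]
      congr 1 with u
      have hp := gaussianPDFReal_pos 0 (τ + s) u hτs
      simp only [hL]
      rw [gaussianPDF, gaussianPDF, ← ENNReal.ofReal_pow
        (div_nonneg (gaussianPDFReal_nonneg _ _ _) hp.le), ← ENNReal.ofReal_mul hp.le,
        ← ENNReal.ofReal_mul (by positivity), ← gaussianPDFReal_sq_div hs hκ]
      congr 1
      field_simp
    simp_rw [hin]
    have h2τ : 2 * (1 / (s + 2 * τ : ℝ)) * τ < 1 := by
      field_simp
      linarith
    rw [lintegral_const_mul _ (by fun_prop),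
      ← lintegral_map (f := fun x => ENNReal.ofReal (Real.exp (1 / (s + 2 * τ) * x ^ 2)))
        (by fun_prop) hm, hτ, lintegral_exp_mul_sq_gaussianReal τ h2τ,
      ← ENNReal.ofReal_mul (by positivity)]
    congr 1
    have : 1 - 2 * (1 / (s + 2 * τ : ℝ)) * τ = s / (s + 2 * τ) := by
      field_simp
      ring
    rw [this, mul_assoc, mul_inv_cancel₀ (by positivity)]
    field_simp
  rw [h1, mul_comm, ← h2]
  exact lintegral_mul_sq_le _ hf hLm

/-! ### Laws of linear forms -/

theorem map_inner_stdGaussian {p : ℕ} (d : EuclideanSpace ℝ (Fin p)) :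
    (stdGaussian (EuclideanSpace ℝ (Fin p))).map (fun z => inner ℝ d z)
      = gaussianReal 0 (‖d‖ ^ 2).toNNReal := by
  have h := IsGaussian.map_eq_gaussianReal (μ := stdGaussian (EuclideanSpace ℝ (Fin p)))
    (InnerProductSpace.toDual ℝ _ d)
  rw [integral_strongDual_stdGaussian, variance_dual_stdGaussian, LinearIsometryEquiv.norm_map] at h
  exact h

theorem map_add_prod {α β : Type*} [MeasurableSpace α] [MeasurableSpace β] {μ : Measure α}
    {ν : Measure β} [SFinite μ] [SFinite ν] {f : α → ℝ} {g : β → ℝ} (hf : Measurable f)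
    (hg : Measurable g) {s t : ℝ} (hs : 0 ≤ s) (ht : 0 ≤ t)
    (hμ : μ.map f = gaussianReal 0 s.toNNReal) (hν : ν.map g = gaussianReal 0 t.toNNReal) :
    (μ.prod ν).map (fun q => f q.1 + g q.2) = gaussianReal 0 (s + t).toNNReal := by
  have h := gaussianReal_conv_gaussianReal (m₁ := 0) (m₂ := 0) (v₁ := s.toNNReal)
    (v₂ := t.toNNReal)
  rw [add_zero, ← hμ, ← hν, Measure.conv, Measure.map_prod_map _ _ hf hg,
    Measure.map_map (by fun_prop) (by fun_prop), ← Real.toNNReal_add hs ht] at h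
  exact h

theorem map_mul_gaussianReal (c : ℝ) {s : ℝ} (hs : 0 ≤ s) :
    (gaussianReal 0 s.toNNReal).map (fun x => c * x) = gaussianReal 0 (c ^ 2 * s).toNNReal := by
  rw [gaussianReal_map_const_mul, mul_zero]
  congr 1
  ext
  simp [Real.coe_toNNReal _ hs, Real.coe_toNNReal _ (mul_nonneg (sq_nonneg c) hs)]

theorem integral_sq_gaussianReal (v : ℝ≥0) : ∫ x, x ^ 2 ∂(gaussianReal 0 v) = v := by
  have := variance_of_integral_eq_zero (X := id) (μ := gaussianReal 0 v)
    measurable_id.aemeasurable integral_id_gaussianReal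
  rw [variance_id_gaussianReal] at this
  exact this.symm

section LinearForms

variable {p : ℕ} {μ ν : Measure (EuclideanSpace ℝ (Fin p) × ℝ)}

theorem exists_linear_form (Λ : StrongDual ℝ (EuclideanSpace ℝ (Fin p) × ℝ)) :
    ∃ (d : EuclideanSpace ℝ (Fin p)) (t : ℝ), ⇑Λ = fun q => inner ℝ d q.1 + t * q.2 := by
  refine ⟨(InnerProductSpace.toDual ℝ _).symm (Λ.comp (ContinuousLinearMap.inl ℝ _ ℝ)),
    Λ (0, 1), funext fun q => ?_⟩
  rw [InnerProductSpace.toDual_symm_apply]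
  have : q = (q.1, 0) + q.2 • (0, 1) := by ext <;> simp
  conv_lhs => rw [this, map_add, map_smul]
  simp [mul_comm]

/-- A finite measure on `ℝᵖ × ℝ` is determined by the laws of the linear forms. -/
theorem ext_of_linear_forms [IsFiniteMeasure μ] [IsFiniteMeasure ν]
    (h : ∀ (d : EuclideanSpace ℝ (Fin p)) (t : ℝ),
      μ.map (fun q => inner ℝ d q.1 + t * q.2) = ν.map (fun q => inner ℝ d q.1 + t * q.2)) :
    μ = ν := by
  apply Measure.ext_of_charFunDual
  ext Λ
  obtain ⟨d, t, hΛ⟩ := exists_linear_form Λ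
  rw [charFunDual_eq_charFun_map_one, charFunDual_eq_charFun_map_one, hΛ, h]

theorem isGaussian_of_linear_forms
    (h : ∀ (d : EuclideanSpace ℝ (Fin p)) (t : ℝ), ∃ v : ℝ≥0,
      μ.map (fun q => inner ℝ d q.1 + t * q.2) = gaussianReal 0 v) : IsGaussian μ := by
  refine isGaussian_of_map_eq_gaussianReal fun Λ => ?_
  obtain ⟨d, t, hΛ⟩ := exists_linear_form Λ
  obtain ⟨v, hv⟩ := h d t
  exact ⟨0, v, by rw [hΛ, hv]⟩

end LinearForms

theorem inner_eq_sum {p : ℕ} (x y : EuclideanSpace ℝ (Fin p)) :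
    inner ℝ x y = ∑ i, x i * y i := by
  simp [PiLp.inner_apply, mul_comm]

/-! ### The Gaussian model -/

section Model

variable {p : ℕ} (j : Fin p)

/-- The vector `d` with its `j`-th coordinate replaced by `0`. -/
def eraseCoord (d : EuclideanSpace ℝ (Fin p)) : EuclideanSpace ℝ (Fin p) :=
  WithLp.toLp 2 fun i => if i = j then 0 else d i

/-- The covariates: `a zᵢ` for `i ≠ j`, and `a (⟨ℓ, z⟩ + w g)` for `i = j`. -/
def design (a w : ℝ) (ℓ z : EuclideanSpace ℝ (Fin p)) (g : ℝ) : EuclideanSpace ℝ (Fin p) :=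
  WithLp.toLp 2 fun i => a * if i = j then inner ℝ ℓ z + w * g else z i

/-- The covariates and the response, as a function of the Gaussian sources `((z, g), e)`. -/
def modelMap (a w b σ : ℝ) (ℓ : EuclideanSpace ℝ (Fin p))
    (q : (EuclideanSpace ℝ (Fin p) × ℝ) × ℝ) : EuclideanSpace ℝ (Fin p) × ℝ :=
  (design j a w ℓ q.1.1 q.1.2, a * b * w * q.1.2 + σ * q.2)

/-- The Gaussian sources. -/
def sourceLaw (p : ℕ) : Measure ((EuclideanSpace ℝ (Fin p) × ℝ) × ℝ) :=
  ((stdGaussian (EuclideanSpace ℝ (Fin p))).prod (gaussianReal 0 1)).prod (gaussianReal 0 1)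

instance : IsProbabilityMeasure (sourceLaw p) := by unfold sourceLaw; infer_instance

/-- The joint law of the covariates and the response. -/
def modelLaw (a w b σ : ℝ) (ℓ : EuclideanSpace ℝ (Fin p)) :
    Measure (EuclideanSpace ℝ (Fin p) × ℝ) :=
  (sourceLaw p).map (modelMap j a w b σ ℓ)

/-- The variance of the linear form `(x, y) ↦ ⟨d, x⟩ + t y` in the model. -/
def modelVar (a w b σ : ℝ) (ℓ d : EuclideanSpace ℝ (Fin p)) (t : ℝ) : ℝ :=
  a ^ 2 * ‖eraseCoord j d + d j • ℓ‖ ^ 2 + (a * w * (d j + b * t)) ^ 2 + (t * σ) ^ 2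

theorem measurable_design (a w : ℝ) (ℓ : EuclideanSpace ℝ (Fin p)) :
    Measurable fun q : EuclideanSpace ℝ (Fin p) × ℝ => design j a w ℓ q.1 q.2 := by
  unfold design
  refine (WithLp.measurable_toLp 2 _).comp (measurable_pi_iff.2 fun i => ?_)
  split_ifs <;> fun_prop

theorem measurable_modelMap (a w b σ : ℝ) (ℓ : EuclideanSpace ℝ (Fin p)) :
    Measurable (modelMap j a w b σ ℓ) :=
  ((measurable_design j a w ℓ).comp measurable_fst).prodMk (by fun_prop)

instance (a w b σ : ℝ) (ℓ : EuclideanSpace ℝ (Fin p)) :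
    IsProbabilityMeasure (modelLaw j a w b σ ℓ) :=
  Measure.isProbabilityMeasure_map (measurable_modelMap j a w b σ ℓ).aemeasurable

theorem inner_design (a w : ℝ) (ℓ z d : EuclideanSpace ℝ (Fin p)) (g : ℝ) :
    inner ℝ d (design j a w ℓ z g)
      = inner ℝ (a • (eraseCoord j d + d j • ℓ)) z + a * w * d j * g := by
  have h1 : inner ℝ d (design j a w ℓ z g)
      = a * inner ℝ (eraseCoord j d) z + d j * (a * (inner ℝ ℓ z + w * g)) := by
    rw [inner_eq_sum, inner_eq_sum, Finset.mul_sum,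
      ← Finset.sum_erase_add _ _ (Finset.mem_univ j),
      ← Finset.sum_erase_add _ (fun i => a * (eraseCoord j d i * z i)) (Finset.mem_univ j)]
    have : ∀ i ∈ Finset.univ.erase j, d i * design j a w ℓ z g i
        = a * (eraseCoord j d i * z i) := by
      intro i hi
      simp [design, eraseCoord, Finset.ne_of_mem_erase hi]
      ring
    rw [Finset.sum_congr rfl this]
    simp [design, eraseCoord]
  rw [h1, real_inner_smul_left, inner_add_left, real_inner_smul_left]
  ring

theorem map_form_modelLaw (a w b σ : ℝ) (ℓ d : EuclideanSpace ℝ (Fin p)) (t : ℝ) :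
    (modelLaw j a w b σ ℓ).map (fun q => inner ℝ d q.1 + t * q.2)
      = gaussianReal 0 (modelVar j a w b σ ℓ d t).toNNReal := by
  have hone : (gaussianReal 0 1) = gaussianReal 0 (1 : ℝ).toNNReal := by simp
  have h := map_add_prod
    (f := fun q : EuclideanSpace ℝ (Fin p) × ℝ =>
      inner ℝ (a • (eraseCoord j d + d j • ℓ)) q.1 + (a * w * (d j + b * t)) * q.2)
    (g := fun e => (t * σ) * e) (by fun_prop) (by fun_prop) (by positivity) (by positivity)
    (map_add_prod (by fun_prop) (by fun_prop) (by positivity) (by positivity)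
      (map_inner_stdGaussian (a • (eraseCoord j d + d j • ℓ)))
      (map_mul_gaussianReal (a * w * (d j + b * t)) zero_le_one))
    (map_mul_gaussianReal (t * σ) zero_le_one)
  rw [← hone] at h
  rw [modelLaw, Measure.map_map (by fun_prop) (measurable_modelMap j a w b σ ℓ), sourceLaw]
  convert h using 2
  · ext q
    simp only [Function.comp_apply, modelMap, inner_design]
    ring
  · rw [modelVar, norm_smul, Real.norm_eq_abs, mul_pow |a|, sq_abs, mul_one, mul_one]

instance (a w b σ : ℝ) (ℓ : EuclideanSpace ℝ (Fin p)) : IsGaussian (modelLaw j a w b σ ℓ) :=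
  isGaussian_of_linear_forms fun d t => ⟨_, map_form_modelLaw j a w b σ ℓ d t⟩

/-- The regression vector `b (e_j - ℓ)`. -/
def modelBeta (b : ℝ) (ℓ : EuclideanSpace ℝ (Fin p)) : EuclideanSpace ℝ (Fin p) :=
  b • (EuclideanSpace.single j 1 - ℓ)

/-- Pairing with `e_j - ℓ` subtracts `a ⟨ℓ, z⟩` from the `j`-th covariate; this needs `ℓ j = 0`, so
that `ℓ` pairs only with covariates of the form `a zᵢ`. -/
theorem modelMap_noise (a w b σ : ℝ) {ℓ : EuclideanSpace ℝ (Fin p)} (hℓ : ℓ j = 0)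
    (q : (EuclideanSpace ℝ (Fin p) × ℝ) × ℝ) :
    (modelMap j a w b σ ℓ q).2 - inner ℝ (modelBeta j b ℓ) (modelMap j a w b σ ℓ q).1
      = σ * q.2 := by
  have h1 : eraseCoord j ℓ = ℓ := by
    ext i
    by_cases h : i = j
    · subst h; simp [eraseCoord, hℓ]
    · simp [eraseCoord, h]
  have h2 : eraseCoord j (EuclideanSpace.single j (1 : ℝ)) = 0 := by
    ext i
    by_cases h : i = j <;> simp [eraseCoord, h]
  simp only [modelMap, modelBeta, real_inner_smul_left, inner_sub_left, inner_design, h1, h2, hℓ]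
  simp
  ring

/-! ### The residual is Gaussian and independent of the covariates -/

section Noise

variable (a w b σ : ℝ) {ℓ : EuclideanSpace ℝ (Fin p)}

/-- The residual of the response. -/
def residual (β : EuclideanSpace ℝ (Fin p)) (z : EuclideanSpace ℝ (Fin p) × ℝ) : ℝ :=
  z.2 - inner ℝ β z.1

theorem measurable_residual (β : EuclideanSpace ℝ (Fin p)) : Measurable (residual β) := by
  unfold residual; fun_prop

theorem map_residual_modelLaw (hℓ : ℓ j = 0) :
    (modelLaw j a w b σ ℓ).map (residual (modelBeta j b ℓ))
      = gaussianReal 0 (σ ^ 2).toNNReal := by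
  rw [modelLaw, Measure.map_map (measurable_residual _) (measurable_modelMap j a w b σ ℓ)]
  have : residual (modelBeta j b ℓ) ∘ modelMap j a w b σ ℓ = (fun e => σ * e) ∘ Prod.snd :=
    funext fun q => modelMap_noise j a w b σ hℓ q
  rw [this, ← Measure.map_map (by fun_prop) measurable_snd, sourceLaw, Measure.map_snd_prod,
    measure_univ, one_smul]
  simpa using map_mul_gaussianReal σ zero_le_one

theorem indepFun_residual_fst (hℓ : ℓ j = 0) :
    IndepFun (residual (modelBeta j b ℓ)) Prod.fst (modelLaw j a w b σ ℓ) := by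
  have hm := measurable_modelMap j a w b σ ℓ
  have hr := measurable_residual (modelBeta j b ℓ)
  have h := (indepFun_prod (μ := (stdGaussian (EuclideanSpace ℝ (Fin p))).prod (gaussianReal 0 1))
    (ν := gaussianReal 0 1) (measurable_design j a w ℓ) (measurable_const_mul σ)).symm
  rw [indepFun_iff_measure_inter_preimage_eq_mul] at h ⊢
  intro s t hs ht
  have e1 : residual (modelBeta j b ℓ) ∘ modelMap j a w b σ ℓ = fun q => σ * q.2 :=
    funext fun q => modelMap_noise j a w b σ hℓ q
  rw [modelLaw, Measure.map_apply hm ((hr hs).inter (measurable_fst ht)),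
    Measure.map_apply hm (hr hs), Measure.map_apply hm (measurable_fst ht), Set.preimage_inter,
    ← Set.preimage_comp, ← Set.preimage_comp, e1]
  exact h s t hs ht

theorem memLp_residual (hℓ : ℓ j = 0) :
    MemLp (residual (modelBeta j b ℓ)) 2 (modelLaw j a w b σ ℓ) := by
  have h : MemLp id 2 ((modelLaw j a w b σ ℓ).map (residual (modelBeta j b ℓ))) := by
    rw [map_residual_modelLaw j a w b σ hℓ]
    exact memLp_id_gaussianReal 2
  exact (memLp_map_measure_iff (by fun_prop) (measurable_residual _).aemeasurable).1 h

theorem condExp_comp_residual (hℓ : ℓ j = 0) {φ : ℝ → ℝ} (hφ : Measurable φ) :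
    (modelLaw j a w b σ ℓ)[fun z => φ (residual (modelBeta j b ℓ) z) |
        MeasurableSpace.comap Prod.fst inferInstance]
      =ᵐ[modelLaw j a w b σ ℓ] fun _ => ∫ x, φ x ∂(gaussianReal 0 (σ ^ 2).toNNReal) := by
  have hr := measurable_residual (modelBeta j b ℓ)
  have h := condExp_indep_eq (f := fun z => φ (residual (modelBeta j b ℓ) z)) hr.comap_le
    (measurable_fst.comap_le) (hφ.comp (comap_measurable _)).stronglyMeasurable
    (indepFun_residual_fst j a w b σ hℓ)
  rwa [← integral_map (f := φ) hr.aemeasurable hφ.aestronglyMeasurable,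
    map_residual_modelLaw j a w b σ hℓ] at h

theorem condExp_residual (hℓ : ℓ j = 0) :
    (modelLaw j a w b σ ℓ)[residual (modelBeta j b ℓ) |
        MeasurableSpace.comap Prod.fst inferInstance]
      =ᵐ[modelLaw j a w b σ ℓ] fun _ => 0 := by
  have h := condExp_comp_residual j a w b σ hℓ measurable_id
  simpa [integral_id_gaussianReal] using h

theorem condVar_residual (hℓ : ℓ j = 0) :
    condVar (MeasurableSpace.comap Prod.fst inferInstance) (residual (modelBeta j b ℓ))
      (modelLaw j a w b σ ℓ) =ᵐ[modelLaw j a w b σ ℓ] fun _ => σ ^ 2 := by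
  have h1 := condVar_ae_eq_condExp_sq_sub_sq_condExp
    (m := MeasurableSpace.comap Prod.fst inferInstance) measurable_fst.comap_le
    (memLp_residual j a w b σ hℓ)
  have h2 := condExp_comp_residual j a w b σ hℓ (φ := fun x => x ^ 2) (by fun_prop)
  filter_upwards [h1, h2, condExp_residual j a w b σ hℓ] with z hz1 hz2 hz3
  rw [hz1, Pi.sub_apply, Pi.pow_apply, hz3]
  rw [integral_sq_gaussianReal, Real.coe_toNNReal _ (sq_nonneg σ)] at hz2
  simpa using! hz2

end Noise

/-- The Gaussian model as a data-generating mechanism. -/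
def modelMechanism (a w b : ℝ) (σ : ℝ≥0) (ℓ : EuclideanSpace ℝ (Fin p)) (hℓ : ℓ j = 0) :
    Mechanism p where
  law := modelLaw j a w b σ ℓ
  beta := modelBeta j b ℓ
  sigma := σ
  isProb := inferInstance
  memLp_cov := by
    have : IsGaussian (modelLaw j a w b σ ℓ) := inferInstance
    exact this.memLp_two_id.fst
  memLp_noise := memLp_residual j a w b σ hℓ
  cond_mean := condExp_residual j a w b σ hℓ
  cond_var := condVar_residual j a w b σ hℓ

end Model

/-! ### The Gaussian model lies in the class -/

section Membership

variable {p : ℕ} (j : Fin p)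

theorem norm_sq_eraseCoord_add (d : EuclideanSpace ℝ (Fin p)) {ℓ : EuclideanSpace ℝ (Fin p)}
    (hℓ : ℓ j = 0) (c : ℝ) :
    ‖eraseCoord j d + c • ℓ‖ ^ 2
      = ‖d‖ ^ 2 - d j ^ 2 + 2 * c * inner ℝ ℓ d + c ^ 2 * ‖ℓ‖ ^ 2 := by
  have h1 : d j ^ 2 = ∑ i, if i = j then d i ^ 2 else 0 := by simp
  rw [EuclideanSpace.real_norm_sq_eq, EuclideanSpace.real_norm_sq_eq,
    EuclideanSpace.real_norm_sq_eq, inner_eq_sum, h1, Finset.mul_sum, Finset.mul_sum,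
    ← Finset.sum_sub_distrib, ← Finset.sum_add_distrib, ← Finset.sum_add_distrib]
  refine Finset.sum_congr rfl fun i _ => ?_
  by_cases h : i = j
  · subst h; simp [eraseCoord, hℓ]
  · simp [eraseCoord, h]; ring

variable {a w b σ : ℝ} {ℓ : EuclideanSpace ℝ (Fin p)}

/-- The normalization `w² + ‖ℓ‖² = 1` makes every covariate other than the unused slack have
variance `a²`, leaving only the cross term between `j` and `ℓ`. -/
theorem modelVar_zero (hℓ : ℓ j = 0) (hw : w ^ 2 = 1 - ‖ℓ‖ ^ 2)
    (d : EuclideanSpace ℝ (Fin p)) :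
    modelVar j a w b σ ℓ d 0 = a ^ 2 * (‖d‖ ^ 2 + 2 * d j * inner ℝ ℓ d) := by
  rw [modelVar, norm_sq_eraseCoord_add j d hℓ]
  linear_combination (a ^ 2 * d j ^ 2) * hw

/-- The cross term is at most `2 ‖ℓ‖ ‖d‖²` by Cauchy-Schwarz. This one estimate controls both the
sub-Gaussian norm and the restricted eigenvalue. -/
theorem abs_modelVar_zero_sub_le (hℓ : ℓ j = 0) (hw : w ^ 2 = 1 - ‖ℓ‖ ^ 2) (hr : ‖ℓ‖ ≤ 1 / 8)
    (d : EuclideanSpace ℝ (Fin p)) :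
    |modelVar j a w b σ ℓ d 0 - a ^ 2 * ‖d‖ ^ 2| ≤ a ^ 2 * ‖d‖ ^ 2 / 4 := by
  have h1 : |inner ℝ ℓ d| ≤ 1 / 8 * ‖d‖ := (abs_real_inner_le_norm _ _).trans (by gcongr)
  have h2 : |d j| ≤ ‖d‖ := PiLp.norm_apply_le d j
  rw [modelVar_zero j hℓ hw]
  have h3 : |d j| * |inner ℝ ℓ d| ≤ ‖d‖ * (1 / 8 * ‖d‖) := by gcongr
  have h4 : a ^ 2 * (‖d‖ ^ 2 + 2 * d j * inner ℝ ℓ d) - a ^ 2 * ‖d‖ ^ 2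
      = a ^ 2 * 2 * (d j * inner ℝ ℓ d) := by ring
  rw [h4, abs_mul, abs_of_nonneg (by positivity : 0 ≤ a ^ 2 * 2), abs_mul]
  calc a ^ 2 * 2 * (|d j| * |inner ℝ ℓ d|) ≤ a ^ 2 * 2 * (‖d‖ * (1 / 8 * ‖d‖)) := by gcongr
    _ = _ := by ring

theorem map_inner_fst_modelLaw (a w b σ : ℝ) (ℓ d : EuclideanSpace ℝ (Fin p)) :
    (modelLaw j a w b σ ℓ).map (fun q => inner ℝ d q.1)
      = gaussianReal 0 (modelVar j a w b σ ℓ d 0).toNNReal := by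
  simpa using map_form_modelLaw j a w b σ ℓ d 0

theorem modelVar_nonneg (a w b σ : ℝ) (ℓ d : EuclideanSpace ℝ (Fin p)) (t : ℝ) :
    0 ≤ modelVar j a w b σ ℓ d t := by
  unfold modelVar; positivity

theorem vecPsiTwoNorm_modelLaw_le {RX : ℝ} (hRX : 0 < RX) (hℓ : ℓ j = 0)
    (hw : w ^ 2 = 1 - ‖ℓ‖ ^ 2) (hr : ‖ℓ‖ ≤ 1 / 8) :
    vecPsiTwoNorm (fun z => z.1) (modelLaw j (RX / 2) w b σ ℓ) ≤ ENNReal.ofReal RX := by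
  refine iSup₂_le fun u hu => ?_
  refine iInf_le_of_le RX.toNNReal (iInf_le_of_le (Real.toNNReal_pos.2 hRX)
    (iInf_le_of_le ?_ le_rfl))
  rw [Real.coe_toNNReal _ hRX.le]
  have hv := (abs_le.1 (abs_modelVar_zero_sub_le (a := RX / 2) (b := b) (σ := σ) j hℓ hw hr u)).2
  rw [hu] at hv
  set v := modelVar j (RX / 2) w b σ ℓ u 0 with hv_def
  have hv0 : 0 ≤ v := modelVar_nonneg j _ _ _ _ _ _ _
  -- With `a = RX / 2` the variance is at most `5 RX² / 16 ≤ 3 RX² / 8`; the value 1/4 is where the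
  -- exponential moment `(√(1/4))⁻¹` equals 2.
  have hq : 1 / 4 ≤ 1 - 2 * (1 / RX ^ 2) * v := by
    rw [← sub_nonneg]
    have : 1 - 2 * (1 / RX ^ 2) * v - 1 / 4 = (3 * RX ^ 2 / 8 - v) * (2 / RX ^ 2) := by
      field_simp; ring
    rw [this]
    refine mul_nonneg ?_ (by positivity)
    nlinarith [sq_nonneg RX]
  have hmeas : Measurable fun x : ℝ => ENNReal.ofReal (Real.exp (1 / RX ^ 2 * x ^ 2)) := by
    fun_prop
  have h := lintegral_exp_mul_sq_gaussianReal v.toNNReal (c := 1 / RX ^ 2)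
    (by rw [Real.coe_toNNReal _ hv0]; linarith)
  rw [hv_def, ← map_inner_fst_modelLaw, lintegral_map hmeas (by fun_prop), ← hv_def,
    Real.coe_toNNReal _ hv0] at h
  calc _ = _ := by
        refine Eq.trans ?_ h
        congr 1 with z
        congr 2
        ring
    _ ≤ ENNReal.ofReal (√(1 / 4))⁻¹ := by
        gcongr
    _ = 2 := by
        rw [show (1 / 4 : ℝ) = (1 / 2) ^ 2 by norm_num, Real.sqrt_sq (by norm_num)]
        norm_num

theorem integral_fst_modelLaw (a w b σ : ℝ) (ℓ : EuclideanSpace ℝ (Fin p)) :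
    ∫ z, z.1 ∂(modelLaw j a w b σ ℓ) = 0 := by
  have hint : Integrable (fun z : EuclideanSpace ℝ (Fin p) × ℝ => z.1)
      (modelLaw j a w b σ ℓ) := (IsGaussian.integrable_id (μ := modelLaw j a w b σ ℓ)).fst
  refine ext_inner_left ℝ fun d => ?_
  rw [← integral_inner hint d, inner_zero_right]
  have := integral_map (μ := modelLaw j a w b σ ℓ) (φ := fun q => inner ℝ d q.1)
    (f := fun x : ℝ => x) (by fun_prop) (by fun_prop)
  rw [← this, map_inner_fst_modelLaw]
  exact integral_id_gaussianReal

theorem memLp_fst_modelLaw (a w b σ : ℝ) (ℓ : EuclideanSpace ℝ (Fin p)) :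
    MemLp (fun z => z.1) 2 (modelLaw j a w b σ ℓ) :=
  (IsGaussian.memLp_two_id (μ := modelLaw j a w b σ ℓ)).fst

theorem dotProduct_secondMoment_modelMechanism (a w b : ℝ) (σ : ℝ≥0) (hℓ : ℓ j = 0)
    (d : Fin p → ℝ) :
    dotProduct d ((modelMechanism j a w b σ ℓ hℓ).secondMoment.mulVec d)
      = modelVar j a w b σ ℓ (WithLp.toLp 2 d) 0 := by
  have hm := memLp_fst_modelLaw j a w b σ ℓ
  have hint : ∀ i k : Fin p, Integrable (fun z : EuclideanSpace ℝ (Fin p) × ℝ => z.1 i * z.1 k)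
      (modelLaw j a w b σ ℓ) := fun i k =>
    MemLp.integrable_mul (hm.eval_piLp i) (hm.eval_piLp k)
  have h1 : dotProduct d ((modelMechanism j a w b σ ℓ hℓ).secondMoment.mulVec d)
      = ∫ z, (inner ℝ (WithLp.toLp 2 d) z.1) ^ 2 ∂(modelLaw j a w b σ ℓ) := by
    simp only [dotProduct, Matrix.mulVec, Mechanism.secondMoment, Matrix.of_apply, inner_eq_sum,
      Finset.mul_sum]
    have : ∀ z : EuclideanSpace ℝ (Fin p) × ℝ, (∑ i, d i * z.1 i) ^ 2
        = ∑ i, ∑ k, d i * (z.1 i * z.1 k * d k) := by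
      intro z
      rw [sq, Finset.sum_mul_sum]
      exact Finset.sum_congr rfl fun i _ => Finset.sum_congr rfl fun k _ => by ring
    simp_rw [this]
    rw [integral_finsetSum _ fun i _ => integrable_finsetSum _ fun k _ =>
      ((hint i k).mul_const _).const_mul _]
    refine Finset.sum_congr rfl fun i _ => ?_
    rw [integral_finsetSum _ fun k _ => ((hint i k).mul_const _).const_mul _]
    refine Finset.sum_congr rfl fun k _ => ?_
    rw [integral_const_mul, integral_mul_const]
    rfl
  have h2 := integral_map (μ := modelLaw j a w b σ ℓ)
    (φ := fun q => inner ℝ (WithLp.toLp 2 d) q.1)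
    (f := fun x : ℝ => x ^ 2) (by fun_prop) (by fun_prop)
  rw [h1, ← h2, map_inner_fst_modelLaw, integral_sq_gaussianReal,
    Real.coe_toNNReal _ (modelVar_nonneg j _ _ _ _ _ _ _)]

/-- A lower bound on the whole quadratic form suffices, since the denominator in `phiSq` is a
partial sum of squares. -/
theorem satisfiesRE_of_le {p : ℕ} {A : Matrix (Fin p) (Fin p) ℝ} {Φ : ℝ} (hΦ : 0 ≤ Φ)
    (h : ∀ d : Fin p → ℝ, Φ * ∑ i, d i ^ 2 ≤ dotProduct d (A.mulVec d)) (s : ℕ) :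
    SatisfiesRE A s Φ := by
  refine le_iInf fun S => le_iInf fun _ => le_iInf fun d => le_iInf fun hd => le_iInf fun hc => ?_
  rw [EReal.coe_le_coe_iff]
  -- Division by zero would give the value 0, below `Φ`. The cone condition excludes it: a vector
  -- vanishing on `S` would vanish everywhere.
  have hpos : 0 < ∑ i ∈ reSupport s S d, d i ^ 2 := by
    obtain ⟨i, hi⟩ : ∃ i ∈ S, d i ≠ 0 := by
      by_contra! hS
      have h0 : ∑ i ∈ S, |d i| = 0 := Finset.sum_eq_zero fun i hi => by simp [hS i hi]
      rw [h0] at hc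
      have h1 := (Finset.sum_eq_zero_iff_of_nonneg fun i _ => abs_nonneg (d i)).1
        (le_antisymm hc (Finset.sum_nonneg fun i _ => abs_nonneg _))
      refine hd (funext fun i => ?_)
      by_cases hi : i ∈ S
      · exact hS i hi
      · exact abs_eq_zero.1 (h1 i (Finset.mem_compl.2 hi))
    exact Finset.sum_pos' (fun _ _ => sq_nonneg _)
      ⟨i, Finset.mem_union_left _ hi.1, by have := hi.2; positivity⟩
  rw [le_div_iff₀ hpos]
  refine le_trans ?_ (h d)
  gcongr
  exact Finset.subset_univ _

theorem norm_sq_modelBeta_sub (b : ℝ) (ℓ ℓ' : EuclideanSpace ℝ (Fin p)) :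
    ‖modelBeta j b ℓ - modelBeta j b ℓ'‖ ^ 2 = b ^ 2 * ‖ℓ - ℓ'‖ ^ 2 := by
  have : modelBeta j b ℓ - modelBeta j b ℓ' = b • (ℓ' - ℓ) := by
    simp only [modelBeta, ← smul_sub]; congr 1; abel
  rw [this, norm_smul, mul_pow, Real.norm_eq_abs, sq_abs, norm_sub_rev]

theorem norm_sq_modelBeta (b : ℝ) (hℓ : ℓ j = 0) :
    ‖modelBeta j b ℓ‖ ^ 2 = b ^ 2 * (1 + ‖ℓ‖ ^ 2) := by
  rw [modelBeta, norm_smul, mul_pow, Real.norm_eq_abs, sq_abs, norm_sub_sq_real]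
  simp [EuclideanSpace.inner_single_left, hℓ]

/-- The lower variance bound `(3/4) (RX/2)² = 3 RX² / 16` is the threshold imposed on `Φ`. The
choice `b² = B² / 2` leaves room for the factor `1 + ‖ℓ‖²`, and one unit of sparsity is kept for
coordinate `j`. -/
theorem modelMechanism_mem_classHD {RX R B Φ w b : ℝ} {s : ℕ} (hRX : 0 < RX) (hB : 0 < B)
    (hΦ : 0 < Φ) (hΦRX : Φ < 3 * RX ^ 2 / 16) (hR : 0 < R) (hℓ : ℓ j = 0)
    (hw : w ^ 2 = 1 - ‖ℓ‖ ^ 2) (hr : ‖ℓ‖ ≤ 1 / 8) (hb : b ^ 2 = B ^ 2 / 2)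
    (hs : Finset.card {i | ℓ i ≠ 0} + 1 ≤ s) :
    modelMechanism j (RX / 2) w b R.toNNReal ℓ hℓ ∈ classHD p RX R B s Φ := by
  refine ⟨vecPsiTwoNorm_modelLaw_le j hRX hℓ hw hr, integral_fst_modelLaw j _ _ _ _ _,
    ⟨?_, ?_⟩, ?_, ?_, ?_, ?_⟩
  · intro t
    have h := integrable_exp_mul_gaussianReal (μ := 0) (v := ((R.toNNReal : ℝ) ^ 2).toNNReal) t
    rw [← map_residual_modelLaw j (RX / 2) w b R.toNNReal hℓ,
      integrable_map_measure (by fun_prop) (measurable_residual _).aemeasurable] at h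
    exact h
  · intro t
    have h := mgf_gaussianReal (map_residual_modelLaw j (RX / 2) w b R.toNNReal hℓ) t
    refine h.le.trans_eq ?_
    rw [zero_mul, zero_add, Real.coe_toNNReal _ (sq_nonneg _)]
    rfl
  · refine satisfiesRE_of_le hΦ.le (fun d => ?_) s
    rw [dotProduct_secondMoment_modelMechanism]
    have h := (abs_le.1 (abs_modelVar_zero_sub_le (a := RX / 2) (b := b)
      (σ := (R.toNNReal : ℝ)) j hℓ hw hr (WithLp.toLp 2 d))).1
    have hn : ‖WithLp.toLp 2 d‖ ^ 2 = ∑ i, d i ^ 2 := EuclideanSpace.real_norm_sq_eq _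
    rw [hn] at h
    have h0 : 0 ≤ ∑ i, d i ^ 2 := Finset.sum_nonneg fun _ _ => sq_nonneg _
    nlinarith
  · refine le_trans ?_ hs
    have : Finset.filter (fun i => modelBeta j b ℓ i ≠ 0) Finset.univ
        ⊆ insert j (Finset.filter (fun i => ℓ i ≠ 0) Finset.univ) := by
      intro i hi
      by_cases h : i = j
      · simp [h]
      · simp only [Finset.mem_filter, Finset.mem_univ, true_and, Finset.mem_insert] at hi ⊢
        right
        intro h0
        exact hi (by simp [modelBeta, h, h0])
    exact (Finset.card_le_card this).trans (Finset.card_insert_le _ _)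
  · refine (pow_le_pow_iff_left₀ (norm_nonneg _) hB.le two_ne_zero).1 ?_
    refine (norm_sq_modelBeta j b hℓ).trans_le ?_
    rw [hb]
    have : ‖ℓ‖ ^ 2 ≤ (1 / 8) ^ 2 := by gcongr
    nlinarith [sq_nonneg B]
  · exact (Real.coe_toNNReal _ hR.le).le

end Membership

/-! ### Comparison of partial observations -/

section Pattern

variable {p : ℕ} (j : Fin p)

/-- The vector `x` with the coordinates outside `T` replaced by `0`. -/
def maskVec (T : Finset (Fin p)) (x : EuclideanSpace ℝ (Fin p)) : EuclideanSpace ℝ (Fin p) :=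
  WithLp.toLp 2 fun i => if i ∈ T then x i else 0

/-- The observation `(x, y)` with the covariates outside `T` replaced by `0`. -/
def maskObs (T : Finset (Fin p)) (q : EuclideanSpace ℝ (Fin p) × ℝ) :
    EuclideanSpace ℝ (Fin p) × ℝ :=
  (maskVec T q.1, q.2)

theorem measurable_maskObs (T : Finset (Fin p)) : Measurable (maskObs T) := by
  refine Measurable.prodMk ?_ measurable_snd
  refine (WithLp.measurable_toLp 2 _).comp (measurable_pi_iff.2 fun i => ?_)
  split_ifs <;> fun_prop

theorem measurable_restrictObs (T : Finset (Fin p)) : Measurable (restrictObs T) := by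
  unfold restrictObs
  exact (measurable_pi_iff.2 fun i => by fun_prop).prodMk measurable_snd

theorem restrictObs_maskObs (T : Finset (Fin p)) (q : EuclideanSpace ℝ (Fin p) × ℝ) :
    restrictObs T (maskObs T q) = restrictObs T q := by
  simp [restrictObs, maskObs, maskVec]

theorem inner_maskVec (T : Finset (Fin p)) (d x : EuclideanSpace ℝ (Fin p)) :
    inner ℝ d (maskVec T x) = inner ℝ (maskVec T d) x := by
  simp [inner_eq_sum, maskVec]

theorem maskVec_maskVec (T : Finset (Fin p)) (x : EuclideanSpace ℝ (Fin p)) :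
    maskVec T (maskVec T x) = maskVec T x := by
  ext i; by_cases h : i ∈ T <;> simp [maskVec, h]

theorem maskVec_univ (x : EuclideanSpace ℝ (Fin p)) : maskVec Finset.univ x = x := by
  ext i; simp [maskVec]

theorem norm_sq_maskVec (T : Finset (Fin p)) (x : EuclideanSpace ℝ (Fin p)) :
    ‖maskVec T x‖ ^ 2 = ∑ i, if i ∈ T then x i ^ 2 else 0 := by
  rw [EuclideanSpace.real_norm_sq_eq]
  refine Finset.sum_congr rfl fun i _ => ?_
  by_cases h : i ∈ T <;> simp [maskVec, h]

theorem norm_sq_maskVec_le (T : Finset (Fin p)) (x : EuclideanSpace ℝ (Fin p)) :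
    ‖maskVec T x‖ ^ 2 ≤ ‖x‖ ^ 2 := by
  rw [norm_sq_maskVec, EuclideanSpace.real_norm_sq_eq]
  refine Finset.sum_le_sum fun i _ => ?_
  split_ifs
  · exact le_rfl
  · positivity

variable (a w b σ : ℝ)

/-- Observations which do not contain the `j`-th covariate carry no information on `ℓ`. -/
theorem map_maskObs_modelLaw_of_notMem {T : Finset (Fin p)} (hj : j ∉ T)
    (ℓ ℓ' : EuclideanSpace ℝ (Fin p)) :
    (modelLaw j a w b σ ℓ).map (maskObs T) = (modelLaw j a w b σ ℓ').map (maskObs T) := by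
  rw [modelLaw, modelLaw, Measure.map_map (measurable_maskObs T) (measurable_modelMap _ _ _ _ _ _),
    Measure.map_map (measurable_maskObs T) (measurable_modelMap _ _ _ _ _ _)]
  congr 1
  ext q : 1
  refine Prod.ext ?_ rfl
  ext i
  by_cases hi : i ∈ T
  · have hij : i ≠ j := fun h => hj (h ▸ hi)
    simp [maskObs, maskVec, modelMap, design, hij]
  · simp [maskObs, maskVec, hi]

theorem map_form_map_maskObs_modelLaw (T : Finset (Fin p))
    (ℓ d : EuclideanSpace ℝ (Fin p)) (t : ℝ) :
    ((modelLaw j a w b σ ℓ).map (maskObs T)).map (fun q => inner ℝ d q.1 + t * q.2)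
      = gaussianReal 0 (modelVar j a w b σ ℓ (maskVec T d) t).toNNReal := by
  rw [Measure.map_map (by fun_prop) (measurable_maskObs T), ← map_form_modelLaw]
  congr 1
  ext q
  simp [maskObs, inner_maskVec]

/-! ### Regression of the `j`-th covariate on the response -/

variable (η : ℝ)

/-- The masked observation as a function of `((z, u), (f, g))`, where `z` are the normalised
covariates, `f` is the response, and the normalised `j`-th covariate is `u + η f + g`. -/
def obsMap (T : Finset (Fin p)) (q : (EuclideanSpace ℝ (Fin p) × ℝ) × (ℝ × ℝ)) :
    EuclideanSpace ℝ (Fin p) × ℝ :=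
  (WithLp.toLp 2 fun i => a * if i = j then q.1.2 + η * q.2.1 + q.2.2 else
    if i ∈ T then q.1.1 i else 0, q.2.1)

theorem measurable_obsMap (T : Finset (Fin p)) : Measurable (obsMap j a η T) := by
  refine Measurable.prodMk ?_ (by fun_prop)
  refine (WithLp.measurable_toLp 2 _).comp (measurable_pi_iff.2 fun i => ?_)
  split_ifs <;> fun_prop

theorem inner_obsMap (T : Finset (Fin p)) (d : EuclideanSpace ℝ (Fin p))
    (q : (EuclideanSpace ℝ (Fin p) × ℝ) × (ℝ × ℝ)) :
    inner ℝ d (obsMap j a η T q).1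
      = a * inner ℝ (eraseCoord j (maskVec T d)) q.1.1
        + a * d j * (q.1.2 + η * q.2.1 + q.2.2) := by
  rw [inner_eq_sum, inner_eq_sum, Finset.mul_sum,
    ← Finset.sum_erase_add _ _ (Finset.mem_univ j),
    ← Finset.sum_erase_add _ (fun i => a * (eraseCoord j (maskVec T d) i * q.1.1 i))
      (Finset.mem_univ j)]
  have : ∀ i ∈ Finset.univ.erase j, d i * (obsMap j a η T q).1 i
      = a * (eraseCoord j (maskVec T d) i * q.1.1 i) := by
    intro i hi
    by_cases h : i ∈ T
    · simp [obsMap, eraseCoord, maskVec, Finset.ne_of_mem_erase hi, h]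
      ring
    · simp [obsMap, eraseCoord, maskVec, Finset.ne_of_mem_erase hi, h]
  rw [Finset.sum_congr rfl this]
  simp [obsMap, eraseCoord]
  ring

/-- The joint law of the normalised covariates and of `⟨ℓ, z⟩` plus noise of variance `s`. -/
def shiftLaw (ℓ : EuclideanSpace ℝ (Fin p)) (s : ℝ) : Measure (EuclideanSpace ℝ (Fin p) × ℝ) :=
  ((stdGaussian (EuclideanSpace ℝ (Fin p))).prod (gaussianReal 0 s.toNNReal)).map
    fun q => (q.1, inner ℝ ℓ q.1 + q.2)

instance (ℓ : EuclideanSpace ℝ (Fin p)) (s : ℝ) : IsProbabilityMeasure (shiftLaw ℓ s) :=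
  Measure.isProbabilityMeasure_map (Measurable.aemeasurable (by fun_prop))

theorem shiftLaw_zero (s : ℝ) : shiftLaw (0 : EuclideanSpace ℝ (Fin p)) s
    = (stdGaussian (EuclideanSpace ℝ (Fin p))).prod (gaussianReal 0 s.toNNReal) := by
  simp [shiftLaw]

theorem chiSqLE_shiftLaw (ℓ : EuclideanSpace ℝ (Fin p)) {s : ℝ} (hs : 0 < s) :
    ChiSqLE (shiftLaw ℓ s) (shiftLaw 0 (‖ℓ‖ ^ 2 + s)) (ENNReal.ofReal (1 + ‖ℓ‖ ^ 2 / s)) := by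
  have h := chiSqLE_gaussian_shift (stdGaussian (EuclideanSpace ℝ (Fin p)))
    (m := fun z => inner ℝ ℓ z) (by fun_prop) (map_inner_stdGaussian ℓ)
    (Real.toNNReal_pos.2 hs).ne'
  rw [shiftLaw_zero, shiftLaw, Real.toNNReal_add (by positivity) hs.le]
  rwa [Real.coe_toNNReal _ hs.le, Real.coe_toNNReal _ (by positivity)] at h

theorem map_form_map_obsMap (T : Finset (Fin p)) (ℓ : EuclideanSpace ℝ (Fin p)) {s lam κ : ℝ} (hs : 0 ≤ s) (hlam : 0 ≤ lam) (hκ : 0 ≤ κ)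
    (d : EuclideanSpace ℝ (Fin p)) (t : ℝ) :
    (((shiftLaw ℓ s).prod ((gaussianReal 0 lam.toNNReal).prod
        (gaussianReal 0 κ.toNNReal))).map (obsMap j a η T)).map
          (fun q => inner ℝ d q.1 + t * q.2)
      = gaussianReal 0 (a ^ 2 * ‖eraseCoord j (maskVec T d) + d j • ℓ‖ ^ 2 + (a * d j) ^ 2 * s
          + ((a * d j * η + t) ^ 2 * lam + (a * d j) ^ 2 * κ)).toNNReal := by
  have h1 : (shiftLaw ℓ s).map (fun q => inner ℝ (a • eraseCoord j (maskVec T d)) q.1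
        + a * d j * q.2)
      = gaussianReal 0 (‖a • (eraseCoord j (maskVec T d) + d j • ℓ)‖ ^ 2
        + (a * d j) ^ 2 * s).toNNReal := by
    rw [shiftLaw, Measure.map_map (by fun_prop) (by fun_prop)]
    have h := map_add_prod (f := fun z => inner ℝ (a • (eraseCoord j (maskVec T d) + d j • ℓ)) z)
      (g := fun e => (a * d j) * e) (by fun_prop) (by fun_prop) (by positivity) (by positivity)
      (map_inner_stdGaussian _) (map_mul_gaussianReal (a * d j) hs)
    rw [← h]
    congr 1
    ext q
    simp only [Function.comp_apply, real_inner_smul_left, inner_add_left]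
    ring
  have h := map_add_prod (by fun_prop) (by fun_prop) (by positivity) (by positivity) h1
    (map_add_prod (by fun_prop) (by fun_prop) (by positivity) (by positivity)
      (map_mul_gaussianReal (a * d j * η + t) hlam) (map_mul_gaussianReal (a * d j) hκ))
  rw [Measure.map_map (by fun_prop) (measurable_obsMap _ _ _ _)]
  convert h using 2
  · ext q
    simp only [Function.comp_apply, inner_obsMap j a η T, real_inner_smul_left]
    simp only [obsMap]
    ring
  · rw [norm_smul, Real.norm_eq_abs, mul_pow |a|, sq_abs]

variable {a w b σ}

/-- The part of the variance of the normalised `j`-th covariate which is explained neither by the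
response nor by the other covariates. -/
def residVar (a w b σ : ℝ) : ℝ := w ^ 2 * σ ^ 2 / (σ ^ 2 + a ^ 2 * b ^ 2 * w ^ 2)

/-- The coefficient `a b w² / (σ² + a² b² w²)` is that of the regression of `w g` on the response,
and `residVar` is the variance left over. Both laws are centred Gaussian, so equality of the
variances of all linear forms is enough; `h` is what remains of it once the response is split off.
-/
theorem map_maskObs_modelLaw_eq {T : Finset (Fin p)} (hj : j ∈ T) (hσ : 0 < σ)
    {ℓ ℓ' : EuclideanSpace ℝ (Fin p)} {s κ : ℝ} (hs : 0 ≤ s) (hκ : 0 ≤ κ)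
    (h : ∀ d, ‖eraseCoord j (maskVec T d) + d j • ℓ‖ ^ 2 + d j ^ 2 * residVar a w b σ
      = ‖eraseCoord j (maskVec T d) + d j • ℓ'‖ ^ 2 + d j ^ 2 * (s + κ)) :
    (modelLaw j a w b σ ℓ).map (maskObs T)
      = ((shiftLaw ℓ' s).prod ((gaussianReal 0 (σ ^ 2 + a ^ 2 * b ^ 2 * w ^ 2).toNNReal).prod
        (gaussianReal 0 κ.toNNReal))).map
          (obsMap j a (a * b * w ^ 2 / (σ ^ 2 + a ^ 2 * b ^ 2 * w ^ 2)) T) := by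
  have : IsProbabilityMeasure ((modelLaw j a w b σ ℓ).map (maskObs T)) :=
    Measure.isProbabilityMeasure_map (measurable_maskObs T).aemeasurable
  have : IsProbabilityMeasure (((shiftLaw ℓ' s).prod
      ((gaussianReal 0 (σ ^ 2 + a ^ 2 * b ^ 2 * w ^ 2).toNNReal).prod
        (gaussianReal 0 κ.toNNReal))).map
          (obsMap j a (a * b * w ^ 2 / (σ ^ 2 + a ^ 2 * b ^ 2 * w ^ 2)) T)) :=
    Measure.isProbabilityMeasure_map (measurable_obsMap _ _ _ _).aemeasurable
  refine ext_of_linear_forms fun d t => ?_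
  rw [map_form_map_maskObs_modelLaw, map_form_map_obsMap j a _ T _ hs (by positivity) hκ]
  congr 2
  have hd : maskVec T d j = d j := by simp [maskVec, hj]
  rw [modelVar, hd]
  have hpos : 0 < σ ^ 2 + a ^ 2 * b ^ 2 * w ^ 2 := by positivity
  have h1 : (a * d j * (a * b * w ^ 2 / (σ ^ 2 + a ^ 2 * b ^ 2 * w ^ 2)) + t) ^ 2
        * (σ ^ 2 + a ^ 2 * b ^ 2 * w ^ 2) + a ^ 2 * d j ^ 2 * residVar a w b σ
      = (a * w * (d j + b * t)) ^ 2 + (t * σ) ^ 2 := by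
    unfold residVar
    field_simp
    ring
  linear_combination a ^ 2 * h d - h1

theorem residVar_pos (hw : w ≠ 0) (hσ : 0 < σ) : 0 < residVar a w b σ := by
  unfold residVar; positivity

/-- The reference model for the models with `‖ℓ‖ = r`. -/
def refVec (r : ℝ) : EuclideanSpace ℝ (Fin p) := EuclideanSpace.single j r

theorem norm_sq_eraseCoord_add_refVec (d : EuclideanSpace ℝ (Fin p)) (c r : ℝ) :
    ‖eraseCoord j d + c • refVec j r‖ ^ 2 = ‖eraseCoord j d‖ ^ 2 + c ^ 2 * r ^ 2 := by
  rw [norm_add_sq_real, norm_smul, mul_pow, Real.norm_eq_abs, sq_abs]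
  simp [refVec, real_inner_smul_right, EuclideanSpace.inner_single_right, eraseCoord]

/-- The unobserved part of `⟨ℓ, z⟩` acts as independent noise of variance `‖ℓ‖² - ‖ℓ_T‖²`. Both laws
are then images under the same map of a shift law times a common factor, so `chiSqLE_shiftLaw`
passes to them. In the reference model `ℓ` is replaced by `‖ℓ‖ e_j`, which feeds in the source `z_j`
that no other covariate uses. -/
theorem chiSqLE_map_maskObs {T : Finset (Fin p)} (hj : j ∈ T) (hσ : 0 < σ) (hw : w ≠ 0)
    {ℓ : EuclideanSpace ℝ (Fin p)} (hℓ : ℓ j = 0) :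
    ChiSqLE ((modelLaw j a w b σ ℓ).map (maskObs T))
      ((modelLaw j a w b σ (refVec j ‖ℓ‖)).map (maskObs T))
      (ENNReal.ofReal (1 + ‖maskVec T ℓ‖ ^ 2 / residVar a w b σ)) := by
  have hs := residVar_pos (a := a) (b := b) hw hσ
  have hκ : 0 ≤ ‖ℓ‖ ^ 2 - ‖maskVec T ℓ‖ ^ 2 := sub_nonneg.2 (norm_sq_maskVec_le T ℓ)
  have hTℓ : maskVec T ℓ j = 0 := by simp [maskVec, hℓ]
  rw [map_maskObs_modelLaw_eq j hj hσ (ℓ := ℓ) (ℓ' := maskVec T ℓ) hs.le hκ,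
    map_maskObs_modelLaw_eq j hj hσ (ℓ := refVec j ‖ℓ‖) (ℓ' := 0)
      (s := ‖maskVec T ℓ‖ ^ 2 + residVar a w b σ) (by positivity) hκ]
  · have h := (chiSqLE_shiftLaw (maskVec T ℓ) hs).prod
      (ChiSqLE.refl ((gaussianReal 0 (σ ^ 2 + a ^ 2 * b ^ 2 * w ^ 2).toNNReal).prod
        (gaussianReal 0 (‖ℓ‖ ^ 2 - ‖maskVec T ℓ‖ ^ 2).toNNReal)))
    rw [mul_one] at h
    exact h.map (measurable_obsMap _ _ _ _)
  · intro d
    rw [norm_sq_eraseCoord_add_refVec, smul_zero, add_zero]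
    ring
  · intro d
    rw [norm_sq_eraseCoord_add j _ hℓ, norm_sq_eraseCoord_add j _ hTℓ,
      ← inner_maskVec T ℓ (maskVec T d), maskVec_maskVec]
    ring

end Pattern

/-! ### A packing by subsets with small intersections -/

/-- The polynomial with coefficients `c`. -/
def coeffPoly {F : Type*} [Field F] {m : ℕ} (c : Fin m → F) : Polynomial F :=
  ((Polynomial.degreeLTEquiv F m).symm c : Polynomial.degreeLT F m)

/-- The agreement points are roots of a nonzero polynomial of degree less than `m`. -/
theorem card_eval_coeffPoly_eq_lt {F : Type*} [Field F] [DecidableEq F] {m k : ℕ}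
    {x : Fin k → F} (hx : Function.Injective x) {c c' : Fin m → F} (hc : c ≠ c') :
    (Finset.univ.filter fun l =>
      (coeffPoly c).eval (x l) = (coeffPoly c').eval (x l)).card < m := by
  have hne : coeffPoly c - coeffPoly c' ≠ 0 := by
    rw [sub_ne_zero]
    intro h
    exact hc ((Polynomial.degreeLTEquiv F m).symm.injective (Subtype.ext h))
  have hdeg : (coeffPoly c - coeffPoly c').degree < m := by
    rw [← Polynomial.mem_degreeLT]
    exact Submodule.sub_mem _ (Subtype.mem _) (Subtype.mem _)
  have hle : (Finset.univ.filter fun l =>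
      (coeffPoly c).eval (x l) = (coeffPoly c').eval (x l)).card
      ≤ (coeffPoly c - coeffPoly c').roots.toFinset.card := by
    refine Finset.card_le_card_of_injOn x (fun l hl => ?_) hx.injOn
    have hl' : (coeffPoly c).eval (x l) = (coeffPoly c').eval (x l) := by simpa using hl
    simp [hne, hl']
  have h2 := (hle.trans (Multiset.toFinset_card_le _)).trans
    (Polynomial.card_roots' (coeffPoly c - coeffPoly c'))
  rw [Polynomial.degree_eq_natDegree hne] at hdeg
  exact h2.trans_lt (by exact_mod_cast hdeg)

/-- The graph of a function, seen as a subset of the target of an embedding. -/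
def graphSet {α F : Type*} [DecidableEq α] {k : ℕ} (e : Fin k × F → α) (g : Fin k → F) :
    Finset α :=
  Finset.univ.image fun l => e (l, g l)

theorem card_graphSet {α F : Type*} [DecidableEq α] {k : ℕ} {e : Fin k × F → α}
    (he : Function.Injective e) (g : Fin k → F) : (graphSet e g).card = k := by
  rw [graphSet, Finset.card_image_of_injective _ fun l l' h => (Prod.ext_iff.1 (he h)).1]
  simp

theorem card_graphSet_inter_le {α F : Type*} [DecidableEq α] [DecidableEq F] {k : ℕ}
    {e : Fin k × F → α} (he : Function.Injective e) (g g' : Fin k → F) :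
    (graphSet e g ∩ graphSet e g').card ≤ (Finset.univ.filter fun l => g l = g' l).card := by
  have : graphSet e g ∩ graphSet e g'
      ⊆ (Finset.univ.filter fun l => g l = g' l).image fun l => e (l, g l) := by
    intro i hi
    simp only [graphSet, Finset.mem_inter, Finset.mem_image, Finset.mem_univ, true_and] at hi
    obtain ⟨⟨l, hl⟩, l', hl'⟩ := hi
    have h := Prod.ext_iff.1 (he (hl.trans hl'.symm))
    obtain rfl : l = l' := h.1
    exact Finset.mem_image.2 ⟨l, by simpa using h.2, hl⟩
  exact (Finset.card_le_card this).trans Finset.card_image_le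

/-- A Reed-Solomon code: the sets are graphs, over `k` points of a prime field of order `P`, of
polynomials of degree less than `m`, about `k/2`. Distinct graphs share at most `m - 1 < k/2`
points, and there are `P ^ m` of them. -/
theorem exists_packing {p k : ℕ} (j : Fin p) (hk : 1 ≤ k) (hp : 24 * k ^ 2 + 2 ≤ p) :
    ∃ 𝓕 : Finset (Finset (Fin p)), (∀ S ∈ 𝓕, j ∉ S ∧ S.card = k) ∧
      (∀ S ∈ 𝓕, ∀ T ∈ 𝓕, S ≠ T → 2 * (S ∩ T).card ≤ k) ∧
      4 * Real.exp (k * Real.log (((p : ℝ) - 1) / (2 * k)) / 15) ≤ 𝓕.card := by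
  have hq : 24 * k ≤ (p - 1) / k := by
    rw [Nat.le_div_iff_mul_le (by omega)]
    have : 24 * k * k = 24 * k ^ 2 := by ring
    omega
  -- Bertrand's postulate gives a prime `P ≤ q` with `q + 1 ≤ 2P`: then `k P ≤ p - 1` for the
  -- embedding, while `P ≥ (p - 1) / (2k)` for the count.
  obtain ⟨P, hP, hP1, hP2⟩ := Nat.exists_prime_lt_and_le_two_mul ((p - 1) / k / 2) (by omega)
  have hqk : (p - 1) / k * k ≤ p - 1 := Nat.div_mul_le_self _ _
  have hqk' : p - 1 < ((p - 1) / k + 1) * k := by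
    rw [mul_comm]; exact Nat.lt_mul_div_succ _ (by omega)
  set q := (p - 1) / k
  have : Fact P.Prime := ⟨hP⟩
  have hPq : P ≤ q := by omega
  have hkP : k ≤ P := by omega
  have hcard : Fintype.card (Fin k × ZMod P) ≤ Fintype.card {i : Fin p // i ≠ j} := by
    simp only [Fintype.card_prod, Fintype.card_fin, ZMod.card]
    rw [Fintype.card_subtype_compl]
    simp only [Fintype.card_fin, Fintype.card_unique]
    calc k * P ≤ q * k := by rw [mul_comm]; gcongr
      _ ≤ p - 1 := hqk
  obtain ⟨e⟩ := Function.Embedding.nonempty_of_card_le hcard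
  have he : Function.Injective fun x => (e x : Fin p) := Subtype.val_injective.comp e.injective
  have hx : Function.Injective fun l : Fin k => ((l : ℕ) : ZMod P) := by
    intro l l' h
    have h' := (ZMod.natCast_eq_natCast_iff _ _ _).1 h
    exact Fin.ext (Nat.ModEq.eq_of_lt_of_lt h' (l.2.trans_le hkP) (l'.2.trans_le hkP))
  obtain ⟨m, hm1, hm2, hm3⟩ : ∃ m, 1 ≤ m ∧ k ≤ 2 * m ∧ 2 * (m - 1) < k :=
    ⟨(k + 1) / 2, by omega, by omega, by omega⟩
  set S : (Fin m → ZMod P) → Finset (Fin p) := fun c =>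
    graphSet (fun x => (e x : Fin p)) fun l => (coeffPoly c).eval ((l : ℕ) : ZMod P) with hS
  have hinter : ∀ c c', c ≠ c' → 2 * (S c ∩ S c').card < k := by
    intro c c' hc
    have h1 := card_graphSet_inter_le he
      (fun l => (coeffPoly c).eval ((l : ℕ) : ZMod P))
      (fun l => (coeffPoly c').eval ((l : ℕ) : ZMod P))
    have h2 := card_eval_coeffPoly_eq_lt hx hc
    simp only [hS]
    omega
  have hinj : Function.Injective S := by
    intro c c' h
    by_contra hc
    have h1 := hinter c c' hc
    rw [h, Finset.inter_self, hS, card_graphSet he] at h1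
    omega
  refine ⟨Finset.univ.image S, ?_, ?_, ?_⟩
  · intro T hT
    obtain ⟨c, -, rfl⟩ := Finset.mem_image.1 hT
    refine ⟨fun hj => ?_, card_graphSet he _⟩
    obtain ⟨l, -, hl⟩ := Finset.mem_image.1 hj
    exact (e _).2 hl
  · intro T hT T' hT' hne
    obtain ⟨c, -, rfl⟩ := Finset.mem_image.1 hT
    obtain ⟨c', -, rfl⟩ := Finset.mem_image.1 hT'
    exact (hinter c c' fun h => hne (h ▸ rfl)).le
  · rw [Finset.card_image_of_injective _ hinj, Finset.card_univ, Fintype.card_fun, ZMod.card,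
      Fintype.card_fin]
    have hk0 : (0 : ℝ) < k := by exact_mod_cast hk
    have hp1 : (1 : ℝ) < p := by exact_mod_cast (show 1 < p by omega)
    have hP0 : (0 : ℝ) < P := by exact_mod_cast hP.pos
    have hLP : Real.log (((p : ℝ) - 1) / (2 * k)) ≤ Real.log P := by
      refine Real.log_le_log (div_pos (by linarith) (by linarith)) ?_
      rw [div_le_iff₀ (by linarith)]
      have h1 : (q + 1) * k ≤ 2 * P * k := by gcongr; omega
      have h2 : p ≤ P * (2 * k) + 1 := by
        have : 2 * P * k = P * (2 * k) := by ring
        omega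
      have : (p : ℝ) ≤ P * (2 * k) + 1 := by exact_mod_cast h2
      linarith
    have h8 : 3 * Real.log 2 ≤ Real.log P := by
      rw [← Real.log_rpow two_pos]
      refine Real.log_le_log (by positivity) ?_
      norm_num
      exact_mod_cast (show 8 ≤ P by omega)
    have hl2 := Real.log_pos one_lt_two
    have hkm : (k : ℝ) ≤ 2 * m := by exact_mod_cast hm2
    have hm1' : (1 : ℝ) ≤ m := by exact_mod_cast hm1
    have h4 : (4 : ℝ) = Real.exp (2 * Real.log 2) := by
      rw [← Real.log_rpow two_pos, Real.exp_log (by positivity)]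
      norm_num
    have hPm : ((P ^ m : ℕ) : ℝ) = Real.exp (m * Real.log P) := by
      rw [Real.exp_nat_mul, Real.exp_log hP0]
      push_cast
      rfl
    -- Since `k ≤ 2m`, the exponent costs at most `(2/15) m log P`; since `P ≥ 8`, the factor 4
    -- costs at most `(2/3) m log P`. The sum is below `m log P`.
    rw [hPm, h4, ← Real.exp_add]
    apply Real.exp_le_exp.2
    have h5 : (k : ℝ) * Real.log (((p : ℝ) - 1) / (2 * k)) ≤ 2 * m * Real.log P := by
      calc _ ≤ (k : ℝ) * Real.log P := by gcongr
        _ ≤ _ := by gcongr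
    have h6 : Real.log P ≤ m * Real.log P := le_mul_of_one_le_left (by linarith) hm1'
    nlinarith

/-! ### Comparison of the laws of the data -/

section Data

variable {p K : ℕ} (O : Fin K → Finset (Fin p)) (n : Fin K → ℕ) (N : ℕ)

/-- The law of the data when `(X, Y)` has law `μ`. -/
def sampleLaw (μ : Measure (EuclideanSpace ℝ (Fin p) × ℝ)) : Measure (SampleSpace O n N) :=
  (Measure.pi fun k => Measure.pi fun _ : Fin (n k) => μ.map (restrictObs (O k))).prod
    (Measure.pi fun _ : Fin N => μ.map Prod.fst)

theorem isProbabilityMeasure_sampleLaw (μ : Measure (EuclideanSpace ℝ (Fin p) × ℝ))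
    [IsProbabilityMeasure μ] : IsProbabilityMeasure (sampleLaw O n N μ) := by
  have : ∀ T : Finset (Fin p), IsProbabilityMeasure (μ.map (restrictObs T)) := fun T =>
    Measure.isProbabilityMeasure_map (measurable_restrictObs T).aemeasurable
  have : IsProbabilityMeasure (μ.map Prod.fst) :=
    Measure.isProbabilityMeasure_map measurable_fst.aemeasurable
  unfold sampleLaw
  infer_instance

theorem chiSqLE_sampleLaw {μ ν : Measure (EuclideanSpace ℝ (Fin p) × ℝ)}
    [IsProbabilityMeasure μ] [IsProbabilityMeasure ν] {τ : Finset (Fin p) → ℝ}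
    (h : ∀ T, ChiSqLE (μ.map (maskObs T)) (ν.map (maskObs T)) (ENNReal.ofReal (Real.exp (τ T)))) :
    ChiSqLE (sampleLaw O n N μ) (sampleLaw O n N ν)
      (ENNReal.ofReal (Real.exp (∑ k, n k * τ (O k) + N * τ Finset.univ))) := by
  have hprob : ∀ (μ : Measure (EuclideanSpace ℝ (Fin p) × ℝ)) [IsProbabilityMeasure μ]
      (T : Finset (Fin p)), IsProbabilityMeasure (μ.map (restrictObs T)) := fun μ _ T =>
    Measure.isProbabilityMeasure_map (measurable_restrictObs T).aemeasurable
  have hprob' : ∀ (μ : Measure (EuclideanSpace ℝ (Fin p) × ℝ)) [IsProbabilityMeasure μ],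
      IsProbabilityMeasure (μ.map Prod.fst) := fun μ _ =>
    Measure.isProbabilityMeasure_map measurable_fst.aemeasurable
  have hobs : ∀ T, ChiSqLE (μ.map (restrictObs T)) (ν.map (restrictObs T))
      (ENNReal.ofReal (Real.exp (τ T))) := by
    intro T
    have h' := (h T).map (measurable_restrictObs T)
    rw [Measure.map_map (measurable_restrictObs T) (measurable_maskObs T),
      Measure.map_map (measurable_restrictObs T) (measurable_maskObs T)] at h'
    rwa [show restrictObs T ∘ maskObs T = restrictObs T from
      funext fun q => restrictObs_maskObs T q] at h'
  have hfst : ChiSqLE (μ.map Prod.fst) (ν.map Prod.fst)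
      (ENNReal.ofReal (Real.exp (τ Finset.univ))) := by
    have h' := (h Finset.univ).map measurable_fst
    rw [Measure.map_map measurable_fst (measurable_maskObs _),
      Measure.map_map measurable_fst (measurable_maskObs _)] at h'
    rwa [show Prod.fst ∘ maskObs Finset.univ = (Prod.fst : EuclideanSpace ℝ (Fin p) × ℝ → _) from
      funext fun q => maskVec_univ q.1] at h'
  have hall := (ChiSqLE.pi fun k => ChiSqLE.pi fun _ : Fin (n k) => hobs (O k)).prod
    (ChiSqLE.pi fun _ : Fin N => hfst)
  refine hall.mono (le_of_eq ?_)
  simp only [Finset.prod_const, Finset.card_univ, Fintype.card_fin]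
  rw [Real.exp_add, ENNReal.ofReal_mul (by positivity), Real.exp_sum,
    ENNReal.ofReal_prod_of_nonneg fun _ _ => by positivity]
  simp_rw [Real.exp_nat_mul, ENNReal.ofReal_pow (Real.exp_pos _).le]

variable (j : Fin p) {a w b σ : ℝ}

/-- Exchanging the sums weights the pair count of `(i, j)` by `ℓ i ^ 2`; the uncontrolled pair `(j,
j)` has weight zero. -/
theorem sum_mul_norm_sq_maskVec_le {ℓ : EuclideanSpace ℝ (Fin p)} (hℓ : ℓ j = 0) {D : ℝ}
    (hD : ∀ i, i ≠ j → ∑ k, (n k : ℝ) * (if i ∈ O k ∧ j ∈ O k then 1 else 0) ≤ D) :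
    ∑ k, (n k : ℝ) * (if j ∈ O k then ‖maskVec (O k) ℓ‖ ^ 2 else 0) ≤ D * ‖ℓ‖ ^ 2 := by
  calc ∑ k, (n k : ℝ) * (if j ∈ O k then ‖maskVec (O k) ℓ‖ ^ 2 else 0)
      = ∑ k, ∑ i, ℓ i ^ 2 * ((n k : ℝ) * (if i ∈ O k ∧ j ∈ O k then 1 else 0)) := by
        refine Finset.sum_congr rfl fun k _ => ?_
        by_cases h : j ∈ O k
        · rw [if_pos h, norm_sq_maskVec, Finset.mul_sum]
          refine Finset.sum_congr rfl fun i _ => ?_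
          by_cases hi : i ∈ O k <;> simp [h, hi, mul_comm]
        · simp [h]
    _ = ∑ i, ℓ i ^ 2 * ∑ k, (n k : ℝ) * (if i ∈ O k ∧ j ∈ O k then 1 else 0) := by
        rw [Finset.sum_comm]
        simp_rw [Finset.mul_sum]
    _ ≤ ∑ i, ℓ i ^ 2 * D := by
        refine Finset.sum_le_sum fun i _ => ?_
        by_cases hi : i = j
        · simp [hi, hℓ]
        · exact mul_le_mul_of_nonneg_left (hD i hi) (sq_nonneg _)
    _ = D * ‖ℓ‖ ^ 2 := by
        rw [← Finset.sum_mul, EuclideanSpace.real_norm_sq_eq, mul_comm]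

theorem chiSqLE_sampleLaw_modelLaw (hσ : 0 < σ) (hw : w ≠ 0) {ℓ : EuclideanSpace ℝ (Fin p)}
    (hℓ : ℓ j = 0) {D : ℝ}
    (hD : ∀ i, i ≠ j → ∑ k, (n k : ℝ) * (if i ∈ O k ∧ j ∈ O k then 1 else 0) ≤ D) :
    ChiSqLE (sampleLaw O n N (modelLaw j a w b σ ℓ))
      (sampleLaw O n N (modelLaw j a w b σ (refVec j ‖ℓ‖)))
      (ENNReal.ofReal (Real.exp ((D + N) * ‖ℓ‖ ^ 2 / residVar a w b σ))) := by
  have hs := residVar_pos (a := a) (b := b) hw hσ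
  have h := chiSqLE_sampleLaw O n N (μ := modelLaw j a w b σ ℓ)
    (ν := modelLaw j a w b σ (refVec j ‖ℓ‖))
    (τ := fun T => (if j ∈ T then ‖maskVec T ℓ‖ ^ 2 else 0) / residVar a w b σ) ?_
  · refine h.mono (ENNReal.ofReal_le_ofReal (Real.exp_le_exp.2 ?_))
    rw [if_pos (Finset.mem_univ j), maskVec_univ]
    simp_rw [← mul_div_assoc]
    rw [← Finset.sum_div, ← add_div, add_mul]
    gcongr
    exact sum_mul_norm_sq_maskVec_le O n j hℓ hD
  · intro T
    by_cases hj : j ∈ T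
    · refine (chiSqLE_map_maskObs j hj hσ hw hℓ).mono (ENNReal.ofReal_le_ofReal ?_)
      -- The bound `1 + x ≤ exp x` makes the constants of independent observations add in the
      -- exponent.
      rw [if_pos hj, add_comm]
      exact Real.add_one_le_exp _
    · rw [map_maskObs_modelLaw_of_notMem j a w b σ hj ℓ (refVec j ‖ℓ‖)]
      have : IsProbabilityMeasure ((modelLaw j a w b σ (refVec j ‖ℓ‖)).map (maskObs T)) :=
        Measure.isProbabilityMeasure_map (measurable_maskObs T).aemeasurable
      refine (ChiSqLE.refl _).mono ?_
      simp [hj]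

end Data

/-! ### From many hypotheses to a lower bound on the risk -/

/-- The balls of radius `D` around the `β i` have disjoint preimages under the estimator, so their
`Q`-masses sum to at most 1. If each had `P i`-mass above 1/2, each `Q`-mass would exceed `1 /
(4c)`, contradicting `4c ≤ card ι`. Markov's inequality off such a ball gives the risk. -/
theorem exists_le_lintegral_norm_sub_sq {ι 𝒳 E : Type*} [Fintype ι] [MeasurableSpace 𝒳]
    [NormedAddCommGroup E] {P : ι → Measure 𝒳} [∀ i, IsProbabilityMeasure (P i)]
    {Q : Measure 𝒳} [IsProbabilityMeasure Q] {c D : ℝ} (hc : 0 < c)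
    (hcard : 4 * c ≤ Fintype.card ι) (hP : ∀ i, ChiSqLE (P i) Q (ENNReal.ofReal c))
    {β : ι → E} (hβ : ∀ i i', i ≠ i' → 2 * D ≤ ‖β i - β i'‖) (hD : 0 ≤ D)
    {f : 𝒳 → E} (hf : ∀ i, Measurable fun x => ‖f x - β i‖) :
    ∃ i, ENNReal.ofReal (D ^ 2 / 2) ≤ ∫⁻ x, ENNReal.ofReal (‖f x - β i‖ ^ 2) ∂(P i) := by
  set A : ι → Set 𝒳 := fun i => {x | ‖f x - β i‖ < D} with hA
  have hAm : ∀ i, MeasurableSet (A i) := fun i => measurableSet_lt (hf i) measurable_const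
  have hdisj : Pairwise (Function.onFun Disjoint A) := by
    intro i i' hii
    refine Set.disjoint_left.2 fun x (hx : ‖f x - β i‖ < D) (hx' : ‖f x - β i'‖ < D) => ?_
    have h1 := hβ i i' hii
    have h2 : ‖β i - β i'‖ ≤ ‖f x - β i‖ + ‖f x - β i'‖ := by
      rw [norm_sub_rev (f x) (β i)]
      simpa using norm_add_le (β i - f x) (f x - β i')
    linarith
  obtain ⟨i, hi⟩ : ∃ i, (P i).real (A i) ≤ 1 / 2 := by
    by_contra! hall
    have hQ : ∑ i, Q.real (A i) ≤ 1 := by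
      rw [← measureReal_iUnion_fintype hdisj hAm]
      exact measureReal_le_one
    have h1 : ∀ i, 1 / 4 < c * Q.real (A i) := by
      intro i
      have h := ENNReal.toReal_mono (by finiteness) ((hP i).measure_sq_le (hAm i))
      rw [ENNReal.toReal_pow, ENNReal.toReal_mul, ENNReal.toReal_ofReal hc.le] at h
      change (P i).real (A i) ^ 2 ≤ c * Q.real (A i) at h
      have := hall i
      nlinarith
    have hne : Nonempty ι := by
      rw [← Fintype.card_pos_iff]
      have : (0 : ℝ) < Fintype.card ι := by linarith
      exact_mod_cast this
    have h2 : ∑ _i : ι, (1 / 4 : ℝ) < ∑ i, c * Q.real (A i) :=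
      Finset.sum_lt_sum_of_nonempty Finset.univ_nonempty fun i _ => h1 i
    rw [← Finset.mul_sum, Finset.sum_const, Finset.card_univ, nsmul_eq_mul] at h2
    nlinarith
  refine ⟨i, ?_⟩
  have hcompl : 1 / 2 ≤ (P i).real (A i)ᶜ := by
    rw [probReal_compl_eq_one_sub (hAm i)]
    linarith
  calc ENNReal.ofReal (D ^ 2 / 2) ≤ ENNReal.ofReal (D ^ 2 * (P i).real (A i)ᶜ) := by
        apply ENNReal.ofReal_le_ofReal
        nlinarith [sq_nonneg D]
    _ = ENNReal.ofReal (D ^ 2) * P i (A i)ᶜ := by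
        rw [ENNReal.ofReal_mul (sq_nonneg D), ofReal_measureReal]
    _ ≤ ENNReal.ofReal (D ^ 2)
          * P i {x | ENNReal.ofReal (D ^ 2) ≤ ENNReal.ofReal (‖f x - β i‖ ^ 2)} := by
        gcongr
        intro x hx
        have hx' : D ≤ ‖f x - β i‖ := not_lt.1 hx
        exact ENNReal.ofReal_le_ofReal (by gcongr)
    _ ≤ _ := mul_meas_ge_le_lintegral ((hf i).pow_const 2).ennreal_ofReal _

/-! ### The family of regression directions -/

/-- The vector with entries `c` on `S` and `0` elsewhere. -/
def indicatorVec {p : ℕ} (c : ℝ) (S : Finset (Fin p)) : EuclideanSpace ℝ (Fin p) :=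
  WithLp.toLp 2 fun i => if i ∈ S then c else 0

theorem norm_sq_indicatorVec {p : ℕ} (c : ℝ) (S : Finset (Fin p)) :
    ‖indicatorVec c S‖ ^ 2 = S.card * c ^ 2 := by
  rw [EuclideanSpace.real_norm_sq_eq]
  simp [indicatorVec]

theorem le_norm_sq_indicatorVec_sub {p k : ℕ} (c : ℝ) {S T : Finset (Fin p)} (hS : S.card = k)
    (hT : T.card = k) (h : 2 * (S ∩ T).card ≤ k) :
    k * c ^ 2 ≤ ‖indicatorVec c S - indicatorVec c T‖ ^ 2 := by
  have h1 : ‖indicatorVec c S - indicatorVec c T‖ ^ 2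
      = S.card * c ^ 2 + T.card * c ^ 2 - 2 * (S ∩ T).card * c ^ 2 := by
    rw [norm_sub_sq_real, norm_sq_indicatorVec, norm_sq_indicatorVec, inner_eq_sum]
    have : ∀ i, indicatorVec c S i * indicatorVec c T i = if i ∈ S ∩ T then c ^ 2 else 0 := by
      intro i
      by_cases hi : i ∈ S <;> by_cases hi' : i ∈ T <;> simp [indicatorVec, hi, hi', sq]
    simp_rw [this]
    rw [Finset.sum_ite_mem, Finset.univ_inter, Finset.sum_const, nsmul_eq_mul]
    ring
  have h2 : (2 * (S ∩ T).card : ℝ) ≤ k := by exact_mod_cast h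
  rw [h1, hS, hT]
  nlinarith [sq_nonneg c]

/-! ### The minimax lower bound -/

/-- Precisions add: `1 / residVar = 1 / w² + a² b² / σ²`, and `w²` is close to 1. -/
theorem one_div_residVar_le {RX R B w b x : ℝ} (hR : 0 < R) (hw0 : w ≠ 0)
    (hb : b ^ 2 = B ^ 2 / 2) (hw : w ^ 2 = 1 - x) (hx : x ≤ 1 / 64) :
    1 / residVar (RX / 2) w b R ≤ 2 * (1 + RX ^ 2 * B ^ 2 / (8 * R ^ 2)) := by
  have h1 : 1 / residVar (RX / 2) w b R = 1 / w ^ 2 + RX ^ 2 * B ^ 2 / (8 * R ^ 2) := by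
    unfold residVar
    rw [hb]
    field_simp
    ring
  have h2 : 1 / w ^ 2 ≤ 2 := by
    rw [hw, div_le_iff₀ (by linarith)]
    linarith
  have h3 : 0 ≤ RX ^ 2 * B ^ 2 / (8 * R ^ 2) := by positivity
  rw [h1]
  linarith

theorem dataLaw_modelMechanism {p K : ℕ} (O : Fin K → Finset (Fin p)) (n : Fin K → ℕ) (N : ℕ)
    (j : Fin p) (a w b : ℝ) (σ : ℝ≥0) {ℓ : EuclideanSpace ℝ (Fin p)} (hℓ : ℓ j = 0) :
    dataLaw O n N (modelMechanism j a w b σ ℓ hℓ) = sampleLaw O n N (modelLaw j a w b σ ℓ) :=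
  rfl

theorem modelMechanism_beta {p : ℕ} (j : Fin p) (a w b : ℝ) (σ : ℝ≥0)
    {ℓ : EuclideanSpace ℝ (Fin p)} (hℓ : ℓ j = 0) :
    (modelMechanism j a w b σ ℓ hℓ).beta = modelBeta j b ℓ := rfl

theorem measurable_norm_sub_beta {p K N : ℕ} (O : Fin K → Finset (Fin p)) (n : Fin K → ℕ)
    {Q : Set (Mechanism p)} {f : SampleSpace O n N → EuclideanSpace ℝ (Fin p)}
    (hf : f ∈ estimators O n N Q) {P : Mechanism p} (hP : P ∈ Q)
    {β : EuclideanSpace ℝ (Fin p)} (hβ : P.beta = β) :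
    Measurable fun x => ‖f x - β‖ := by
  subst hβ
  exact hf P hP

theorem measurable_norm_sub_modelBeta {p K N : ℕ} (O : Fin K → Finset (Fin p)) (n : Fin K → ℕ)
    (j : Fin p) {Q : Set (Mechanism p)} {f : SampleSpace O n N → EuclideanSpace ℝ (Fin p)}
    (hf : f ∈ estimators O n N Q) {a w b : ℝ} {σ : ℝ≥0} {ℓ : EuclideanSpace ℝ (Fin p)}
    {hℓ : ℓ j = 0} (h : modelMechanism j a w b σ ℓ hℓ ∈ Q) :
    Measurable fun x => ‖f x - modelBeta j b ℓ‖ :=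
  measurable_norm_sub_beta O n hf h (modelMechanism_beta j a w b σ hℓ)

/-- The minimax risk is at least the separation which the sample size allows, expressed through
the squared amplitude `A` of the entries of the hypotheses. -/
theorem le_minimaxRisk_classHD {p K k N : ℕ} (O : Fin K → Finset (Fin p)) (n : Fin K → ℕ)
    {RX R B Φ D A : ℝ} (hRX : 0 < RX) (hR : 0 < R) (hB : 0 < B) (hΦ : 0 < Φ)
    (hΦRX : Φ < 3 * RX ^ 2 / 16) (j : Fin p)
    (hD : ∀ i, i ≠ j → ∑ k, (n k : ℝ) * (if i ∈ O k ∧ j ∈ O k then 1 else 0) ≤ D)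
    (hk : 1 ≤ k) (hp : 24 * k ^ 2 + 2 ≤ p) (hA0 : 0 ≤ A) (hA : k * A ≤ 1 / 64)
    (hDN : 0 ≤ D + N)
    (hinfo : (D + N) * A * (2 * (1 + RX ^ 2 * B ^ 2 / (8 * R ^ 2)))
      ≤ Real.log (((p : ℝ) - 1) / (2 * k)) / 15) :
    ENNReal.ofReal (B ^ 2 * (k * A) / 16)
      ≤ minimaxRisk O n N (classHD p RX R B (k + 1) Φ) := by
  obtain ⟨𝓕, h𝓕, hinter, hcard⟩ := exists_packing j hk hp
  set ℓ : 𝓕 → EuclideanSpace ℝ (Fin p) := fun S => indicatorVec (√A) S.1 with hℓ_def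
  have hℓj : ∀ S, ℓ S j = 0 := fun S => by simp [hℓ_def, indicatorVec, (h𝓕 S.1 S.2).1]
  have hnorm_sq : ∀ S, ‖ℓ S‖ ^ 2 = k * A := fun S => by
    rw [hℓ_def, norm_sq_indicatorVec, (h𝓕 S.1 S.2).2, Real.sq_sqrt hA0]
  have hnorm : ∀ S, ‖ℓ S‖ = √(k * A) := fun S => by
    rw [← hnorm_sq S, Real.sqrt_sq (norm_nonneg _)]
  have hkA : (0 : ℝ) ≤ k * A := by positivity
  set w := √(1 - k * A)
  have hw : w ^ 2 = 1 - k * A := Real.sq_sqrt (by linarith)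
  have hw0 : w ≠ 0 := by
    intro h
    rw [h] at hw
    linarith
  set b := √(B ^ 2 / 2)
  have hb : b ^ 2 = B ^ 2 / 2 := Real.sq_sqrt (by positivity)
  have hmem : ∀ S, modelMechanism j (RX / 2) w b R.toNNReal (ℓ S) (hℓj S)
      ∈ classHD p RX R B (k + 1) Φ := by
    intro S
    refine modelMechanism_mem_classHD j hRX hB hΦ hΦRX hR (hℓj S) (by rw [hnorm_sq, hw]) ?_ hb ?_
    · rw [hnorm]
      refine Real.sqrt_le_iff.2 ⟨by norm_num, hA.trans_eq (by norm_num)⟩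
    · gcongr
      rw [← (h𝓕 S.1 S.2).2]
      refine Finset.card_le_card fun i hi => ?_
      by_contra h
      simp [hℓ_def, indicatorVec, h] at hi
  have hv := one_div_residVar_le (RX := RX) hR hw0 hb hw hA
  have hRR : ((R.toNNReal : ℝ≥0) : ℝ) = R := Real.coe_toNNReal _ hR.le
  have hchi : ∀ S, ChiSqLE (sampleLaw O n N (modelLaw j (RX / 2) w b R.toNNReal (ℓ S)))
      (sampleLaw O n N (modelLaw j (RX / 2) w b R.toNNReal (refVec j √(k * A))))
      (ENNReal.ofReal (Real.exp (k * Real.log (((p : ℝ) - 1) / (2 * k)) / 15))) := by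
    intro S
    have h := chiSqLE_sampleLaw_modelLaw O n N j (a := RX / 2) (b := b) (σ := (R.toNNReal : ℝ))
      (by rwa [hRR]) hw0 (hℓj S) hD
    rw [hnorm, Real.sq_sqrt hkA] at h
    refine h.mono (ENNReal.ofReal_le_ofReal (Real.exp_le_exp.2 ?_))
    rw [hRR]
    calc (D + N) * (k * A) / residVar (RX / 2) w b R
        = (D + N) * (k * A) * (1 / residVar (RX / 2) w b R) := by ring
      _ ≤ (D + N) * (k * A) * (2 * (1 + RX ^ 2 * B ^ 2 / (8 * R ^ 2))) := by gcongr
      _ = k * ((D + N) * A * (2 * (1 + RX ^ 2 * B ^ 2 / (8 * R ^ 2)))) := by ring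
      _ ≤ k * (Real.log (((p : ℝ) - 1) / (2 * k)) / 15) := by gcongr
      _ = _ := by ring
  refine le_iInf₂ fun f hf => ?_
  have hprob : ∀ ℓ : EuclideanSpace ℝ (Fin p),
      IsProbabilityMeasure (sampleLaw O n N (modelLaw j (RX / 2) w b R.toNNReal ℓ)) :=
    fun _ => isProbabilityMeasure_sampleLaw O n N _
  have hfm := fun S => measurable_norm_sub_modelBeta O n j hf (hmem S)
  have hcard' : 4 * Real.exp (k * Real.log (((p : ℝ) - 1) / (2 * k)) / 15)
      ≤ Fintype.card 𝓕 := by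
    rwa [Fintype.card_coe]
  -- Intersections of size at most `k/2` keep the directions `√(k A)` apart, hence the regression
  -- vectors `b √(k A)` apart; the testing radius is half of that.
  have hsep : ∀ S T, S ≠ T →
      2 * (b * √(k * A) / 2) ≤ ‖modelBeta j b (ℓ S) - modelBeta j b (ℓ T)‖ := by
    intro S T hST
    refine (pow_le_pow_iff_left₀ (by positivity) (norm_nonneg _) two_ne_zero).1 ?_
    rw [norm_sq_modelBeta_sub, show 2 * (b * √(k * A) / 2) = b * √(k * A) by ring, mul_pow,
      Real.sq_sqrt hkA]
    have h := le_norm_sq_indicatorVec_sub (√A) (h𝓕 S.1 S.2).2 (h𝓕 T.1 T.2).2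
      (hinter S.1 S.2 T.1 T.2 fun h => hST (Subtype.ext h))
    rw [Real.sq_sqrt hA0] at h
    gcongr
  obtain ⟨S, hS⟩ := exists_le_lintegral_norm_sub_sq (Real.exp_pos _) hcard' hchi hsep
    (by positivity) hfm
  rw [← dataLaw_modelMechanism O n N j (RX / 2) w b R.toNNReal (hℓj S)] at hS
  refine le_trans ?_ (le_iSup₂_of_le _ (hmem S) hS)
  apply ENNReal.ofReal_le_ofReal
  rw [div_pow, mul_pow, Real.sq_sqrt hkA, hb]
  linarith

end HDMissing

end

/-! ### Choice of the amplitude and the final constants -/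

theorem mainTheorem7 (p K s N : ℕ) (O : Fin K → Finset (Fin p)) (n : Fin K → ℕ)
    (RX R B Φ ρ C : ℝ)
    (hRX : 0 < RX) (hR : 0 < R) (hB : 0 < B) (hΦ : 0 < Φ) (hΦRX : Φ < 3 * RX ^ 2 / 16)
    (hρ0 : 0 < ρ) (hρ1 : ρ < 1) (hC : 1 < C)
    (hbal : ∃ j : Fin p, ∀ i : Fin p, i ≠ j →
      ∑ k, (n k : ℝ) * (if i ∈ O k ∧ j ∈ O k then 1 else 0) ≤ C * ρ ^ 2 * ∑ k, (n k : ℝ))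
    (hs : 2 ≤ s)
    (hps : (p : ℝ) - 2 ≥ 24 * ((s : ℝ) - 1) ^ 2)
    (hsize : C * ρ ^ 2 * ∑ k, (n k : ℝ) + (N : ℝ) ≥
      128 * (s : ℝ) * Real.log ((p : ℝ) - 2) / 9 * max 1 (1 / RX ^ 4) * min (R ^ 2 / B ^ 2) 1) :
    HDMissing.minimaxRisk O n N (HDMissing.classHD p RX R B s Φ) ≥
      ENNReal.ofReal (1 / (2 ^ 17 * C) * min 1 (2 ^ 6 / (3 ^ 2 * RX ^ 4)) *
        (min (R ^ 2) (B ^ 2) * (s : ℝ) * Real.log (((p : ℝ) - 1) / (2 * ((s : ℝ) - 1))) /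
          (ρ ^ 2 * ∑ k, (n k : ℝ) + (N : ℝ)))) := by
  obtain ⟨j, hj⟩ := hbal
  obtain ⟨k, rfl⟩ : ∃ k, s = k + 1 := ⟨s - 1, by omega⟩
  have hk : 1 ≤ k := by omega
  have hk1 : (1 : ℝ) ≤ k := by exact_mod_cast hk
  push_cast at hps hsize ⊢
  rw [add_sub_cancel_right] at hps ⊢
  have hp : 24 * k ^ 2 + 2 ≤ p := by
    have : (24 * k ^ 2 + 2 : ℝ) ≤ p := by linarith
    exact_mod_cast this
  have hp26 : (26 : ℝ) ≤ p := by nlinarith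
  set Λ := Real.log (((p : ℝ) - 1) / (2 * k)) with hΛ
  have hΛ0 : 0 < Λ := by
    refine Real.log_pos ?_
    rw [one_lt_div (by linarith)]
    nlinarith
  have hΛp : Λ ≤ Real.log ((p : ℝ) - 2) := by
    refine Real.log_le_log (div_pos (by linarith) (by linarith)) ?_
    rw [div_le_iff₀ (by linarith)]
    nlinarith
  set T := ∑ k, (n k : ℝ) with hT
  have hT0 : 0 ≤ T := Finset.sum_nonneg fun _ _ => Nat.cast_nonneg _
  set M := C * ρ ^ 2 * T + N with hM
  set q := RX ^ 2 * B ^ 2 / (8 * R ^ 2) with hq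
  have hq0 : 0 < q := by positivity
  set m := max 1 (1 / RX ^ 4) with hm
  have hm1 : 1 ≤ m := le_max_left _ _
  -- For `R ≤ B` the factor `R² / B²` is compensated by `q`, leaving `m RX² / 8` with `m RX² ≥ 1`;
  -- this is the role of `max 1 (1 / RX ^ 4)`.
  have hmin : 1 ≤ 8 * (m * min (R ^ 2 / B ^ 2) 1 * (1 + q)) := by
    rcases le_total (R ^ 2 / B ^ 2) 1 with h | h
    · rw [min_eq_left h]
      have h1 : m * (R ^ 2 / B ^ 2) * q = m * RX ^ 2 / 8 := by
        rw [hq]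
        field_simp
      have h2 : 1 ≤ m * RX ^ 2 := by
        rcases le_total 1 (RX ^ 2) with h' | h'
        · exact one_le_mul_of_one_le_of_one_le hm1 h'
        · calc (1 : ℝ) ≤ 1 / RX ^ 4 * RX ^ 2 := by
                rw [show 1 / RX ^ 4 * RX ^ 2 = 1 / RX ^ 2 by field_simp]
                exact one_le_one_div (by positivity) h'
            _ ≤ m * RX ^ 2 := by gcongr; exact le_max_right _ _
      have h3 : 0 ≤ m * (R ^ 2 / B ^ 2) := by positivity
      linarith
    · rw [min_eq_right h, mul_one]
      have : m ≤ m * (1 + q) := le_mul_of_one_le_right (by linarith) (by linarith)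
      linarith
  have hMk : k * Λ ≤ M * (1 + q) := by
    set lg := Real.log ((p : ℝ) - 2)
    have hlg : 0 < lg := hΛ0.trans_le hΛp
    calc k * Λ ≤ (k + 1) * lg := by gcongr; linarith
      _ ≤ 128 * (k + 1) * lg / 72 * 1 := by
        have : 0 ≤ (k + 1) * lg := by positivity
        linarith
      _ ≤ 128 * (k + 1) * lg / 72 * (8 * (m * min (R ^ 2 / B ^ 2) 1 * (1 + q))) := by gcongr
      _ = 128 * (k + 1) * lg / 9 * m * min (R ^ 2 / B ^ 2) 1 * (1 + q) := by ring
      _ ≤ M * (1 + q) := by gcongr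
  have hM0 : 0 < M := by
    have : 0 < k * Λ := by positivity
    by_contra h
    nlinarith
  -- The sample-size condition enters here, through `hMk`: it keeps `‖ℓ‖² = k A` below 1/64. The
  -- amplitude makes the information equal to `Λ / 32`, within the `Λ / 15` allowed by the packing.
  have hA : k * (Λ / (64 * M * (1 + q))) ≤ 1 / 64 := by
    rw [mul_div_assoc', div_le_div_iff₀ (by positivity) (by norm_num)]
    linarith
  have h := HDMissing.le_minimaxRisk_classHD (N := N) O n hRX hR hB hΦ hΦRX j hj hk hp
    (A := Λ / (64 * M * (1 + q))) (by positivity) hA hM0.le (by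
      rw [← hM, ← hΛ, ← hq]
      have : M * (Λ / (64 * M * (1 + q))) * (2 * (1 + q)) = Λ / 32 := by
        field_simp
        norm_num
      rw [this]
      linarith)
  refine ge_iff_le.2 (le_trans (ENNReal.ofReal_le_ofReal ?_) h)
  set x := min 1 (2 ^ 6 / (3 ^ 2 * RX ^ 4)) with hx
  set μ := min (R ^ 2) (B ^ 2) with hμ
  have hx0 : 0 ≤ x := by positivity
  have hμ0 : 0 ≤ μ := by positivity
  -- The terms `x μ` and `x μ q` are each at most `B²`; the second uses `x RX² ≤ 8` to cancel the 8
  -- in `q` and `μ ≤ R²` to cancel its denominator.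
  have hxμ : x * μ * (1 + q) ≤ 2 * B ^ 2 := by
    have hx1 : x ≤ 1 := min_le_left _ _
    have h1 : x * RX ^ 2 ≤ 8 := by
      rcases le_total (RX ^ 2) 8 with h' | h'
      · calc x * RX ^ 2 ≤ 1 * 8 := by gcongr
          _ = 8 := one_mul 8
      · calc x * RX ^ 2 ≤ 2 ^ 6 / (3 ^ 2 * RX ^ 4) * RX ^ 2 := by
              gcongr
              exact min_le_right _ _
          _ = 64 / 9 / RX ^ 2 := by field_simp; norm_num
          _ ≤ 64 / 9 / 8 := by gcongr
          _ ≤ 8 := by norm_num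
    have h2 : x * μ ≤ 1 * B ^ 2 := by
      gcongr
      exact min_le_right _ _
    have h3 : x * μ * q = x * RX ^ 2 * (B ^ 2 / 8) * (μ / R ^ 2) := by
      rw [hq]
      field_simp
    have h4 : μ / R ^ 2 ≤ 1 := (div_le_one (by positivity)).2 (min_le_left _ _)
    have h5 : x * RX ^ 2 * (B ^ 2 / 8) * (μ / R ^ 2) ≤ 8 * (B ^ 2 / 8) * 1 := by gcongr
    linarith
  have hden : M ≤ C * (ρ ^ 2 * T + N) := by
    have : (N : ℝ) ≤ C * N := le_mul_of_one_le_left (Nat.cast_nonneg _) hC.le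
    rw [hM]
    linarith
  have hden0 : 0 < C * (ρ ^ 2 * T + N) := hM0.trans_le hden
  calc 1 / (2 ^ 17 * C) * x * (μ * (k + 1) * Λ / (ρ ^ 2 * T + N))
      = (x * μ) * ((k + 1) * Λ) / 2 ^ 17 / (C * (ρ ^ 2 * T + N)) := by
        have : 0 < C := by linarith
        have : ρ ^ 2 * T + N ≠ 0 := by
          intro h0
          rw [h0] at hden0
          linarith
        field_simp
    _ ≤ (x * μ) * ((k + 1) * Λ) / 2 ^ 17 / M := by gcongr
    -- Here `s = k + 1 ≤ 2k`; the resulting constant `2⁻¹⁵` is 32 times smaller than the available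
    -- `2⁻¹⁰`.
    _ ≤ (2 * B ^ 2 / (1 + q)) * ((2 * k) * Λ) / 2 ^ 17 / M := by
        gcongr
        · rwa [le_div_iff₀ (by positivity)]
        · linarith
    _ ≤ B ^ 2 * (k * (Λ / (64 * M * (1 + q)))) / 16 := by
        have : (2 * B ^ 2 / (1 + q)) * ((2 * k) * Λ) / 2 ^ 17 / M
            = B ^ 2 * (k * (Λ / (64 * M * (1 + q)))) / 16 * (1 / 32) := by
          field_simp
          norm_num
        rw [this]
        have : 0 ≤ B ^ 2 * (k * (Λ / (64 * M * (1 + q)))) / 16 := by positivity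
        linarith
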